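/- All graphs are finite, simple and undirected; the null graph (no vertices) is allowed, and connected graphs and trees are nonnull. **Definitions.** A *separation* of a graph $G$ is a pair $(A,B)$ of subgraphs of $G$ with $A\cup B=G$ and $E(A\cap B)=\emptyset$; its *order* is $|V(A)\cap V(B)|$. The *rooted $2$-treedepth* $\operatorname{rtd}_2(G)$ is defined recursively: $\operatorname{rtd}_2(G)=0$ if $G$ is the null graph; $\operatorname{rtd}_2(G)=1$ if $G$ has exactly one vertex; otherwise $\operatorname{rtd}_2(G)$ is the minimum of $$\max\{\operatorname{rtd}_2(A),\ \operatorname{rtd}_2(B\setminus V(A))+|V(A)\cap V(B)|\}$$ over all separations $(A,B)$ of $G$ of order at most one with $V(A)\neq\emptyset$ and $V(B)\setminus V(A)\neq\emptyset$. A graph $X$ is a *minor* of $G$ if there are pairwise disjoint sets $B_x\subseteq V(G)$ $(x\in V(X))$ such that each $G[B_x]$ is connected and, for every $xy\in E(X)$, there is an edge of $G$ between $B_x$ and $B_y$. $G$ is *$X$-minor-free* if $X$ is not a minor of $G$. For an ordering $\sigma$ of $V(G)$ and an integer $r\ge 0$, a vertex $v$ is *weakly $r$-reachable* from $u$ if there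 is a path between $u$ and $v$ in $G$ with at most $r$ edges such that $v\le_\sigma w$ for every vertex $w$ of the path. Let $\mathrm{WReach}_r[G,\sigma,u]$ be the set of such $v$, and $$\operatorname{wcol}_r(G)=\min_{\sigma}\max_{u\in V(G)}|\mathrm{WReach}_r[G,\sigma,u]|,$$ with value $0$ for the null graph. A *tree decomposition* of $G$ is a tree $T$ together with sets $W_x\subseteq V(G)$ $(x\in V(T))$ such that for every $u\in V(G)$ the graph $T[\{x: u\in W_x\}]$ is connected (in particular nonnull), and every edge of $G$ has both ends in some $W_x$. Its *width* is $\max_x|W_x|-1$, and $\operatorname{tw}(G)$ is the minimum width of a tree decomposition of $G$ (so $\operatorname{tw}=-1$ for the null graph). **Theorem.** For every integer $t$ with $t\ge 2$ and every graph $X$ with $\operatorname{rtd}_2(X)\le t$, there exists an integer $c$ such that for every $X$-minor-free graph $G$ and every integer $r\ge 2$, $$\operatorname{wcol}_r(G)\le c\cdot(\operatorname{tw}(G)+1)\cdot r^{t-2}\log r ,$$ where $\log$ is the natural logarithm (the choice of base only affects $c$). -/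

import Mathlib

namespace SimpleGraph

/-- `H` is a minor of `G`: there is a model of `H` in `G`, that is, a family of pairwise disjoint
vertex sets of `G`, one for each vertex of `H`, each inducing a connected (in particular nonempty)
subgraph, with an edge of `G` between the sets of any two adjacent vertices of `H`. -/
def IsMinor {W V : Type*} (H : SimpleGraph W) (G : SimpleGraph V) : Prop :=
  ∃ B : W → Set V,
    (∀ x y, x ≠ y → Disjoint (B x) (B y)) ∧
    (∀ x, (G.induce (B x)).Connected) ∧
    (∀ x y, H.Adj x y → ∃ a ∈ B x, ∃ b ∈ B y, G.Adj a b)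

/-- `v` is weakly `r`-reachable from `u` in `(G, σ)`: some path from `u` to `v` with at most `r`
edges has `v` as its `σ`-smallest vertex. A vertex ordering is given by the position `σ w` of each
vertex `w`. -/
def WReach {V : Type*} (G : SimpleGraph V) (σ : V ≃ Fin (Nat.card V)) (r : ℕ) (u : V) : Set V :=
  {v | ∃ p : G.Walk u v, p.IsPath ∧ p.length ≤ r ∧ ∀ w ∈ p.support, σ v ≤ σ w}

/-- The `r`-th weak coloring number of a finite graph: the minimum over all vertex orderings of the
maximum size of a weakly `r`-reachable set (the maximum is `0` for the null graph). -/
noncomputable def wcol {V : Type*} [Finite V] (G : SimpleGraph V) (r : ℕ) : ℕ :=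
  ⨅ σ : V ≃ Fin (Nat.card V), ⨆ u : V, (G.WReach σ r u).ncard

/-- A tree decomposition of `G` over a finite tree. Connectedness includes nonemptiness, so every
vertex lies in some bag. -/
structure TreeDecomposition {V : Type*} (G : SimpleGraph V) where
  node : Type
  finite_node : Finite node
  tree : SimpleGraph node
  isTree : tree.IsTree
  bag : node → Set V
  connected_of_mem : ∀ u : V, (tree.induce {x | u ∈ bag x}).Connected
  exists_bag_of_adj : ∀ u v : V, G.Adj u v → ∃ x, u ∈ bag x ∧ v ∈ bag x

/-- The width of a tree decomposition: the maximum size of a bag, minus one. -/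
noncomputable def TreeDecomposition.width {V : Type*} [Finite V] {G : SimpleGraph V}
    (D : G.TreeDecomposition) : ℤ :=
  ((⨆ x : D.node, (D.bag x).ncard : ℕ) : ℤ) - 1

/-- The treewidth of a finite graph (an integer: it is `-1` for the null graph). -/
noncomputable def treewidth {V : Type*} [Finite V] (G : SimpleGraph V) : ℤ :=
  ⨅ D : G.TreeDecomposition, D.width

/-- `(A, B)` is a separation of `G`; its order is the number of vertices of `A ⊓ B`. -/
def IsSeparation {V : Type*} {G : SimpleGraph V} (A B : G.Subgraph) : Prop :=
  A ⊔ B = ⊤ ∧ (A ⊓ B).edgeSet = ∅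

/-- Rooted 2-treedepth of a finite graph. -/
noncomputable def rtd2 {V : Type*} [Finite V] (G : SimpleGraph V) : ℕ :=
  if Nat.card V = 0 then 0
  else if Nat.card V = 1 then 1
  else sInf {m | ∃ (A B : G.Subgraph) (_ : IsSeparation A B) (_ : (A ⊓ B).verts.ncard ≤ 1)
    (_ : A.verts.Nonempty) (_ : (B.verts \ A.verts).Nonempty),
    m = max (rtd2 A.coe) (rtd2 (B.deleteVerts A.verts).coe + (A ⊓ B).verts.ncard)}
termination_by Nat.card V
decreasing_by
  · rename_i _ _ _ _ hB
    obtain ⟨b, hb⟩ := hB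
    rw [Nat.card_coe_set_eq, ← Set.ncard_univ]
    exact Set.ncard_lt_ncard ((Set.ssubset_univ_iff).2 fun h => hb.2 (h ▸ Set.mem_univ b))
  · rename_i _ _ _ hA _
    obtain ⟨a, ha⟩ := hA
    rw [Nat.card_coe_set_eq, ← Set.ncard_univ]
    refine Set.ncard_lt_ncard ((Set.ssubset_univ_iff).2 fun h => ?_)
    have h' : a ∈ (B.deleteVerts A.verts).verts := h ▸ Set.mem_univ a
    exact h'.2 ha

end SimpleGraph

/-!
A vertex ordering is built for a more general problem, which lends itself to induction. Given a
family `F` of connected vertex sets of `G`, a model of `X` is *rich* if each of its branch sets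
contains a member of `F`. If `G` has no rich model of `X`, then some ordered set `S` of vertices
meets all members of `F`, while few vertices of `S` are weakly `r`-reachable from any vertex
(`HitBound`). For the family of all singletons rich models are models and `S` is the whole vertex
set.

Graphs of rooted 2-treedepth at most `n + 1` are, up to taking subgraphs, obtained from edgeless
graphs by iterating the tower construction `n` times (`isContained_univGraph_of_rtd2_le`): the
vertices of `tower Y` are words, and each word is joined to a copy of `Y` formed by its one-letter
extensions. The bound is proved by induction on `n`, each level by induction on the height of the
towers.

For edgeless graphs the absence of rich models bounds the number of disjoint members of `F`, and
the Erdős–Pósa property yields a hitting set that is a union of boundedly many bags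
(`TreeDecomposition.exists_hitting_set`).

For towers over `Y`, consider a connected root `R` and the rest `C` of a connected set `Z`. The
connected subsets of `C` that touch `R` and contain a tower of height `h` form a family without a
rich model of two copies of `Y`, as this model and the root would form a tower of height `h + 1`
(`not_richModel_attachedTowers`, where `HasTower.reroot` moves the roots of the towers to the places
where they are needed). This family is hit by an ordered set `S₁` coming from the previous level. A
component of `C \ S₁` without a tower of height `h` is treated by induction on `h`. Any other
component `K` is separated from `R`, and if `S₁` is chosen as small as possible then `Z \ K` is
connected (`exists_peeling`), so that `Z \ K` is the root for the next step inside `K`. Walks have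
to cross the resulting layers one after another, so at most about `r` layers are reachable
(`exists_layered_hitting_set`), which costs a factor `r`.

For this choice of `S₁` lengths of walks are measured by the number of visits to `S` (`Tour`, `WR`).
What is cut off from `R` by `K` can then be dropped from `S₁`, because excursions into it are
replaced by free excursions through `K` (`WR_diff_subset`).

On the first level the factor is only logarithmic. As `Y` is edgeless, disjoint sets with towers
that touch a common connected set already form a higher tower, so the layers branch boundedly often
and split into boundedly many linear sequences (`exists_chain_labelling`). In a linear sequence the
layers are ordered by decreasing `2`-adic valuation of their positions, which leaves `O(log r)`
reachable layers (`LayersSeparate.exists_order`).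
-/

namespace SimpleGraph

/-! ### Connected vertex sets and components -/

/-- Some edge of `G` joins a vertex of `A` to a vertex of `B`. -/
def Touches {V : Type*} (G : SimpleGraph V) (A B : Set V) : Prop :=
  ∃ a ∈ A, ∃ b ∈ B, G.Adj a b

/-- `A` is closed under taking neighbours inside `C`. -/
def ClosedIn {V : Type*} (G : SimpleGraph V) (A C : Set V) : Prop :=
  ∀ a ∈ A, ∀ b ∈ C, G.Adj a b → b ∈ A

/-- `C` is nonempty and induces a connected subgraph, phrased through cuts: no proper nonempty
subset of `C` is closed under taking neighbours inside `C`. -/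
def ConnSet {V : Type*} (G : SimpleGraph V) (C : Set V) : Prop :=
  C.Nonempty ∧ ∀ A ⊆ C, A.Nonempty → G.ClosedIn A C → C ⊆ A

/-- `K` is (the vertex set of) a connected component of the subgraph induced by `A`. -/
def IsComp {V : Type*} (G : SimpleGraph V) (A K : Set V) : Prop :=
  K ⊆ A ∧ G.ConnSet K ∧ G.ClosedIn K A

section Conn

variable {V : Type*} {G : SimpleGraph V}

theorem Touches.symm {A B : Set V} (h : G.Touches A B) : G.Touches B A := by
  obtain ⟨a, ha, b, hb, hab⟩ := h
  exact ⟨b, hb, a, ha, hab.symm⟩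

theorem Touches.mono {A B A' B' : Set V} (h : G.Touches A B) (hA : A ⊆ A') (hB : B ⊆ B') :
    G.Touches A' B' := by
  obtain ⟨a, ha, b, hb, hab⟩ := h
  exact ⟨a, hA ha, b, hB hb, hab⟩

theorem ClosedIn.mono {A B C : Set V} (h : G.ClosedIn A C) (hB : B ⊆ C) : G.ClosedIn A B :=
  fun a ha b hb hab => h a ha b (hB hb) hab

theorem ClosedIn.diff {A B C : Set V} (h : G.ClosedIn A C) (hBC : B ⊆ C) :
    G.ClosedIn (B \ A) B := by
  rintro a ⟨ha, haA⟩ b hb hab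
  exact ⟨hb, fun hbA => haA (h b hbA a (hBC ha) hab.symm)⟩

/-- A connected set that meets a closed set lies inside it. -/
theorem ConnSet.subset_of_closedIn {A C K : Set V} (hK : G.ConnSet K) (hKC : K ⊆ C)
    (hA : G.ClosedIn A C) (hne : (K ∩ A).Nonempty) : K ⊆ A := by
  have := hK.2 (K ∩ A) Set.inter_subset_left hne
    (fun a ha b hb hab => ⟨hb, hA a ha.2 b (hKC hb) hab⟩)
  exact fun x hx => (this hx).2

theorem ConnSet.singleton (x : V) : G.ConnSet {x} := by
  refine ⟨⟨x, rfl⟩, ?_⟩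
  rintro A hA ⟨a, ha⟩ - y rfl
  have := hA ha
  rw [Set.mem_singleton_iff] at this
  exact this ▸ ha

/-- Two connected sets with a common vertex or an edge between them have a connected union. -/
theorem ConnSet.union {A B : Set V} (hA : G.ConnSet A) (hB : G.ConnSet B)
    (h : (A ∩ B).Nonempty ∨ G.Touches A B) : G.ConnSet (A ∪ B) := by
  refine ⟨hA.1.mono Set.subset_union_left, fun D hD hne hcl => ?_⟩
  have key : ∀ {X Y : Set V}, G.ConnSet X → G.ConnSet Y → ((X ∩ Y).Nonempty ∨ G.Touches X Y) →
      X ⊆ A ∪ B → Y ⊆ A ∪ B → (X ∩ D).Nonempty → X ⊆ D ∧ Y ⊆ D := by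
    intro X Y hX hY hXY hXs hYs hXD
    have h1 := hX.subset_of_closedIn hXs hcl hXD
    refine ⟨h1, hY.subset_of_closedIn hYs hcl ?_⟩
    rcases hXY with ⟨z, hz⟩ | ⟨x, hx, y, hy, hxy⟩
    · exact ⟨z, hz.2, h1 hz.1⟩
    · exact ⟨y, hy, hcl x (h1 hx) y (hYs hy) hxy⟩
  obtain ⟨d, hd⟩ := hne
  rcases hD hd with hdA | hdB
  · have := key hA hB h Set.subset_union_left Set.subset_union_right ⟨d, hdA, hd⟩
    exact Set.union_subset this.1 this.2
  · have := key hB hA (h.imp (fun h => by rwa [Set.inter_comm]) Touches.symm)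
      Set.subset_union_right Set.subset_union_left ⟨d, hdB, hd⟩
    exact Set.union_subset this.2 this.1

/-- Attaching any family of connected sets to a connected set keeps it connected. -/
theorem ConnSet.union_iUnion {ι : Type*} {P : Set V} {B : ι → Set V} (hP : G.ConnSet P)
    (hB : ∀ i, G.ConnSet (B i)) (h : ∀ i, G.Touches P (B i)) : G.ConnSet (P ∪ ⋃ i, B i) := by
  refine ⟨hP.1.mono Set.subset_union_left, fun D hD hne hcl => ?_⟩
  have hBs : ∀ i, B i ⊆ P ∪ ⋃ i, B i :=
    fun i => (Set.subset_iUnion B i).trans Set.subset_union_right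
  have hPD : P ⊆ D := by
    obtain ⟨d, hd⟩ := hne
    rcases hD hd with hdP | hdB
    · exact hP.subset_of_closedIn Set.subset_union_left hcl ⟨d, hdP, hd⟩
    · obtain ⟨i, hi⟩ := Set.mem_iUnion.1 hdB
      have h1 := (hB i).subset_of_closedIn (hBs i) hcl ⟨d, hi, hd⟩
      obtain ⟨a, ha, b, hb, hab⟩ := h i
      exact hP.subset_of_closedIn Set.subset_union_left hcl
        ⟨a, ha, hcl b (h1 hb) a (Or.inl ha) hab.symm⟩
  refine Set.union_subset hPD (Set.iUnion_subset fun i => ?_)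
  obtain ⟨a, ha, b, hb, hab⟩ := h i
  exact (hB i).subset_of_closedIn (hBs i) hcl ⟨b, hb, hcl a (hPD ha) b (hBs i hb) hab⟩

theorem connSet_iff_induce_connected {C : Set V} : G.ConnSet C ↔ (G.induce C).Connected := by
  constructor
  · rintro ⟨⟨c, hc⟩, h⟩
    have key : ∀ x : C, (G.induce C).Reachable ⟨c, hc⟩ x := by
      have := h {x | ∃ hx : x ∈ C, (G.induce C).Reachable ⟨c, hc⟩ ⟨x, hx⟩}
        (fun x hx => hx.1) ⟨c, hc, Reachable.refl _⟩ (by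
          rintro a ⟨ha, hra⟩ b hb hab
          refine ⟨hb, hra.trans (Adj.reachable ?_)⟩
          simpa using hab)
      rintro ⟨x, hx⟩
      exact (this hx).2
    exact (connected_iff _).2 ⟨fun a b => (key a).symm.trans (key b), ⟨⟨c, hc⟩⟩⟩
  · intro h
    obtain ⟨⟨c, hc⟩⟩ := h.nonempty
    refine ⟨⟨c, hc⟩, ?_⟩
    rintro A hA ⟨a, ha⟩ hcl x hx
    obtain ⟨p⟩ := h.preconnected ⟨a, hA ha⟩ ⟨x, hx⟩
    have key : ∀ (u v : C), (G.induce C).Walk u v → u.1 ∈ A → v.1 ∈ A := by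
      intro u v p
      induction p with
      | nil => exact id
      | cons hadj _ ih => exact fun hu => ih (hcl _ hu _ (Subtype.coe_prop _) (by simpa using hadj))
    exact key _ _ p ha

theorem exists_isComp {A : Set V} {a : V} (ha : a ∈ A) : ∃ K, G.IsComp A K ∧ a ∈ K := by
  set K : Set V := ⋂₀ {T | T ⊆ A ∧ a ∈ T ∧ G.ClosedIn T A} with hK
  have hKA : K ⊆ A := Set.sInter_subset_of_mem ⟨subset_rfl, ha, fun _ _ _ hb _ => hb⟩
  have haK : a ∈ K := by rintro T ⟨-, h, -⟩; exact h
  have hcl : G.ClosedIn K A := fun x hx y hy hxy T hT => hT.2.2 x (hx T hT) y hy hxy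
  refine ⟨K, ⟨hKA, ⟨⟨a, haK⟩, fun B hB hne hBcl => ?_⟩, hcl⟩, haK⟩
  have hBA : G.ClosedIn B A := fun x hx y hy hxy => hBcl x hx y (hcl x (hB hx) y hy hxy) hxy
  by_cases haB : a ∈ B
  · exact Set.sInter_subset_of_mem ⟨hB.trans hKA, haB, hBA⟩
  · have : K ⊆ K \ B := by
      refine Set.sInter_subset_of_mem ⟨Set.sdiff_subset.trans hKA, ⟨haK, haB⟩, ?_⟩
      rintro x ⟨hx, hxB⟩ y hy hxy
      exact ⟨hcl x hx y hy hxy, fun hyB => hxB (hBA y hyB x (hKA hx) hxy.symm)⟩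
    obtain ⟨b, hb⟩ := hne
    exact absurd hb (this (hB hb)).2

theorem IsComp.eq_of_mem {A K K' : Set V} (h : G.IsComp A K) (h' : G.IsComp A K') {x : V}
    (hx : x ∈ K) (hx' : x ∈ K') : K = K' :=
  Set.Subset.antisymm (h.2.1.subset_of_closedIn h.1 h'.2.2 ⟨x, hx, hx'⟩)
    (h'.2.1.subset_of_closedIn h'.1 h.2.2 ⟨x, hx', hx⟩)

theorem IsComp.disjoint_of_ne {A K K' : Set V} (h : G.IsComp A K) (h' : G.IsComp A K')
    (hne : K ≠ K') : Disjoint K K' :=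
  Set.disjoint_left.2 fun _ hx hx' => hne (h.eq_of_mem h' hx hx')

theorem ConnSet.exists_isComp_superset {A B : Set V} (hB : G.ConnSet B) (hBA : B ⊆ A) :
    ∃ K, G.IsComp A K ∧ B ⊆ K := by
  obtain ⟨b, hb⟩ := hB.1
  obtain ⟨K, hK, hbK⟩ := exists_isComp (G := G) (hBA hb)
  exact ⟨K, hK, hB.subset_of_closedIn hBA hK.2.2 ⟨b, hb, hbK⟩⟩

/-- To show that `E` is connected it suffices that every closed part of `E` missing a given
connected subset `R` is empty. -/
theorem ConnSet.of_closedIn_empty {R E : Set V} (hR : G.ConnSet R) (hRE : R ⊆ E)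
    (h : ∀ D ⊆ E, Disjoint D R → G.ClosedIn D E → D = ∅) : G.ConnSet E := by
  refine ⟨hR.1.mono hRE, fun A hA hne hcl => ?_⟩
  have hAR : (R ∩ A).Nonempty := by
    by_contra hcon
    rw [Set.not_nonempty_iff_eq_empty] at hcon
    have := h A hA (Set.disjoint_iff_inter_eq_empty.2 (by rwa [Set.inter_comm])) hcl
    exact hne.ne_empty this
  have hRA := hR.subset_of_closedIn hRE hcl hAR
  have := h (E \ A) Set.sdiff_subset
    (Set.disjoint_left.2 fun x hx hxR => hx.2 (hRA hxR)) (hcl.diff subset_rfl)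
  exact Set.sdiff_eq_empty.1 this

/-- Deleting a component of `Z \ {x}` from a connected set `Z` leaves a connected set. -/
theorem ConnSet.diff_isComp_singleton {Z C : Set V} {x : V} (hZ : G.ConnSet Z) (hx : x ∈ Z)
    (hC : G.IsComp (Z \ {x}) C) : G.ConnSet (Z \ C) := by
  have hxC : x ∉ C := fun h => (hC.1 h).2 rfl
  refine (ConnSet.singleton x).of_closedIn_empty (by simpa using ⟨hx, hxC⟩) ?_
  intro D hD hDx hcl
  by_contra hne
  have hxD : x ∉ D := fun h => Set.disjoint_left.1 hDx h rfl
  refine hxD (hZ.2 D (hD.trans Set.sdiff_subset) (Set.nonempty_iff_ne_empty.2 hne) ?_ hx)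
  intro a ha b hb hab
  by_cases hbC : b ∈ C
  · have haZ : a ∈ Z \ {x} := ⟨(hD ha).1, fun h => hxD (h ▸ ha)⟩
    exact absurd (hC.2.2 b hbC a haZ hab.symm) (hD ha).2
  · exact hcl a ha b ⟨hb, hbC⟩ hab

end Conn

/-! ### Weak reachability into a subset -/

/-- `Tour G S A n a b`: some walk from `a` to `b` inside `A` meets `S` at most `n` times. The set
`A` carries the constraint on the whole walk, and only visits to `S` are paid for. -/
inductive Tour {V : Type*} (G : SimpleGraph V) (S A : Set V) : ℕ → V → V → Prop
  | single {n : ℕ} {a : V} : a ∈ A → (a ∈ S → 1 ≤ n) → Tour G S A n a a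
  | step {n m : ℕ} {a b c : V} : a ∈ A → G.Adj a b → Tour G S A m b c → m ≤ n →
      (a ∈ S → m < n) → Tour G S A n a c

/-- The vertices of `S` that are weakly reachable from `u` inside `C` when only the vertices of `S`
are ordered (by `ρ`, with ties allowed) and the length of a walk is its number of visits to `S`.
Counting visits to `S` instead of edges makes the set insensitive to what happens inside a
component of `C \ S`. -/
def WR {V : Type*} (G : SimpleGraph V) (C S : Set V) (ρ : V → ℕ) (r : ℕ) (u : V) : Set V :=
  {v | v ∈ S ∧ G.Tour S {w | w ∈ C ∧ (w ∈ S → ρ v ≤ ρ w)} r u v}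

/-- There is an ordered set `S ⊆ C` that meets every member of `F` contained in `C`, and from no
vertex are more than `N` vertices of `S` weakly `r`-reachable inside `C`. -/
def HasHittingSet {V : Type*} (G : SimpleGraph V) (F : Set (Set V)) (C : Set V) (r N : ℕ) : Prop :=
  ∃ (S : Set V) (ρ : V → ℕ), S ⊆ C ∧ (∀ f ∈ F, f ⊆ C → (f ∩ S).Nonempty) ∧
    ∀ u, (G.WR C S ρ r u).ncard ≤ N

section Reach

variable {V : Type*} {G : SimpleGraph V}

theorem Tour.mono {S S' A A' : Set V} {n n' : ℕ} {a b : V} (h : G.Tour S A n a b) (hS : S' ⊆ S)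
    (hA : A ⊆ A') (hn : n ≤ n') : G.Tour S' A' n' a b := by
  induction h generalizing n' with
  | single ha h1 => exact Tour.single (hA ha) fun h => (h1 (hS h)).trans hn
  | step ha hab _ hmn h1 ih =>
    exact Tour.step (hA ha) hab (ih le_rfl) (hmn.trans hn) fun h => (h1 (hS h)).trans_le hn

theorem Tour.start_mem {S A : Set V} {n : ℕ} {a b : V} (h : G.Tour S A n a b) : a ∈ A := by
  cases h <;> assumption

theorem Tour.end_mem {S A : Set V} {n : ℕ} {a b : V} (h : G.Tour S A n a b) : b ∈ A := by
  induction h <;> assumption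

/-- A tour that never leaves `B` stays in the component of `B` in which it starts. -/
theorem Tour.inter_isComp {S A B K : Set V} {n : ℕ} {a b : V} (h : G.Tour S A n a b) (hAB : A ⊆ B)
    (hK : G.IsComp B K) (ha : a ∈ K) : G.Tour S (A ∩ K) n a b := by
  induction h with
  | single hA h1 => exact Tour.single ⟨hA, ha⟩ h1
  | step hA hab ht hmn h1 ih =>
    exact Tour.step ⟨hA, ha⟩ hab (ih (hK.2.2 _ ha _ (hAB ht.start_mem) hab)) hmn h1

/-- Inside a connected set that avoids `S` the starting point of a tour may be moved for free. -/
theorem Tour.move_start {S A K : Set V} {n : ℕ} {a b c : V} (h : G.Tour S A n a c)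
    (hK : G.ConnSet K) (hKA : K ⊆ A) (hKS : Disjoint K S) (ha : a ∈ K) (hb : b ∈ K) :
    G.Tour S A n b c := by
  have := hK.2 {x ∈ K | G.Tour S A n x c} (fun _ hx => hx.1) ⟨a, ha, h⟩ (by
    rintro x ⟨hxK, hx⟩ y hy hxy
    exact ⟨hy, Tour.step (hKA hy) hxy.symm hx le_rfl
      fun hyS => absurd hyS (Set.disjoint_left.1 hKS hy)⟩)
  exact (this hb).2

theorem Tour.of_walk {S A : Set V} {a b : V} (p : G.Walk a b) (hA : ∀ w ∈ p.support, w ∈ A) :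
    G.Tour S A (p.length + 1) a b := by
  induction p with
  | nil => exact Tour.single (hA _ (by simp)) fun _ => by simp
  | cons hadj p ih =>
    refine Tour.step (hA _ (by simp)) hadj (ih fun w hw => hA w (by simp [hw])) ?_ ?_ <;> simp

theorem mem_of_mem_WR {C S : Set V} {ρ : V → ℕ} {r : ℕ} {u v : V} (h : v ∈ G.WR C S ρ r u) :
    u ∈ C := h.2.start_mem.1

theorem hasHittingSet_of_forall_not_subset {F : Set (Set V)} {C : Set V} {r N : ℕ}
    (h : ∀ f ∈ F, ¬ f ⊆ C) : G.HasHittingSet F C r N := by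
  refine ⟨∅, fun _ => 0, Set.empty_subset _, fun f hf hfC => absurd hfC (h f hf), fun u => ?_⟩
  have : G.WR C ∅ (fun _ => 0) r u = ∅ := Set.eq_empty_of_forall_notMem fun v hv => hv.1
  simp [this]

theorem HasHittingSet.mono {F : Set (Set V)} {C : Set V} {r N N' : ℕ}
    (h : G.HasHittingSet F C r N) (hN : N ≤ N') : G.HasHittingSet F C r N' := by
  obtain ⟨S, ρ, h1, h2, h3⟩ := h
  exact ⟨S, ρ, h1, h2, fun u => (h3 u).trans hN⟩

/-- Ordered sets chosen separately in the components of `C \ S₁` are placed after an ordered set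
`S₁`. From a vertex of a component only vertices of `S₁` and vertices of the set chosen in this
component become reachable. -/
theorem exists_extension [Finite V] {C S₁ : Set V} {ρ₁ : V → ℕ} (hS₁ : S₁ ⊆ C)
    {Q : Set V → Set V → (V → ℕ) → Prop}
    (h : ∀ K, G.IsComp (C \ S₁) K → ∃ S ρ, S ⊆ K ∧ Q K S ρ) :
    ∃ (S : Set V) (ρ : V → ℕ), S ⊆ C ∧ S₁ ⊆ S ∧
      (∀ u ∈ S₁, ∀ r, G.WR C S ρ r u ⊆ G.WR C S₁ ρ₁ r u) ∧
      ∀ K, G.IsComp (C \ S₁) K → ∃ SK ρK, Q K SK ρK ∧ S ∩ K = SK ∧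
        ∀ u ∈ K, ∀ r, G.WR C S ρ r u ⊆ G.WR C S₁ ρ₁ r u ∪ G.WR K SK ρK r u := by
  classical
  choose! T τ hT hQ using h
  choose! cp hcp hmem using fun a (ha : a ∈ C \ S₁) => exists_isComp (G := G) ha
  obtain ⟨M, hM⟩ : ∃ M, ∀ v, ρ₁ v ≤ M := by
    obtain ⟨M, hM⟩ := (Set.finite_range ρ₁).bddAbove
    exact ⟨M, fun v => hM ⟨v, rfl⟩⟩
  have hcpK : ∀ {K v}, G.IsComp (C \ S₁) K → v ∈ K → cp v = K := fun {K v} hK hv =>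
    (hcp v (hK.1 hv)).eq_of_mem hK (hmem v (hK.1 hv)) hv
  set S : Set V := S₁ ∪ {v | v ∈ C \ S₁ ∧ v ∈ T (cp v)} with hS
  set ρ : V → ℕ := fun v => if v ∈ S₁ then ρ₁ v else M + 1 + τ (cp v) v with hρ
  have hρ1 : ∀ v ∈ S₁, ρ v = ρ₁ v := fun v hv => by simp [hρ, hv]
  have hρ2 : ∀ v, v ∉ S₁ → ρ v = M + 1 + τ (cp v) v := fun v hv => by simp [hρ, hv]
  have hSK : ∀ K, G.IsComp (C \ S₁) K → S ∩ K = T K := by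
    intro K hK
    ext v
    constructor
    · rintro ⟨hv | hv, hvK⟩
      · exact absurd hv (hK.1 hvK).2
      · rw [← hcpK hK hvK]; exact hv.2
    · intro hv
      have hvK := hT K hK hv
      exact ⟨Or.inr ⟨hK.1 hvK, by rwa [hcpK hK hvK]⟩, hvK⟩
  have key1 : ∀ u v r, v ∈ S₁ → v ∈ G.WR C S ρ r u → v ∈ G.WR C S₁ ρ₁ r u := by
    rintro u v r hv ⟨-, ht⟩
    refine ⟨hv, ht.mono Set.subset_union_left ?_ le_rfl⟩
    rintro w ⟨hw, hwS⟩
    refine ⟨hw, fun hw1 => ?_⟩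
    have := hwS (Or.inl hw1)
    rwa [hρ1 v hv, hρ1 w hw1] at this
  have key2 : ∀ u v r, v ∉ S₁ → v ∈ G.WR C S ρ r u →
      {w | w ∈ C ∧ (w ∈ S → ρ v ≤ ρ w)} ⊆ C \ S₁ := by
    rintro u v r hv - w ⟨hw, hwS⟩
    refine ⟨hw, fun hw1 => ?_⟩
    have h1 := hwS (Or.inl hw1)
    rw [hρ2 v hv, hρ1 w hw1] at h1
    have := hM w
    omega
  refine ⟨S, ρ, ?_, Set.subset_union_left, ?_, ?_⟩
  · exact Set.union_subset hS₁ fun v hv => hv.1.1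
  · intro u hu r v hv
    by_cases hv1 : v ∈ S₁
    · exact key1 u v r hv1 hv
    · exact absurd hu (key2 u v r hv1 hv hv.2.start_mem).2
  · intro K hK
    refine ⟨T K, τ K, hQ K hK, hSK K hK, ?_⟩
    intro u hu r v hv
    by_cases hv1 : v ∈ S₁
    · exact Or.inl (key1 u v r hv1 hv)
    · right
      have hsub := key2 u v r hv1 hv
      have ht := hv.2.inter_isComp hsub hK hu
      have hvK : v ∈ K := ht.end_mem.2
      refine ⟨by rw [← hSK K hK]; exact ⟨hv.1, hvK⟩, ht.mono ?_ ?_ le_rfl⟩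
      · rw [← hSK K hK]; exact Set.inter_subset_left
      · rintro w ⟨hw, hwK⟩
        refine ⟨hwK, fun hwT => ?_⟩
        have hwS : w ∈ S := by rw [← hSK K hK] at hwT; exact hwT.1
        have h1 := hw.2 hwS
        rw [hρ2 v hv1, hρ2 w (hK.1 hwK).2, hcpK hK hvK, hcpK hK hwK] at h1
        omega

theorem hasHittingSet_of_comps [Finite V] {F : Set (Set V)} (hF : ∀ f ∈ F, G.ConnSet f)
    {C S₁ : Set V} {ρ₁ : V → ℕ} (hS₁ : S₁ ⊆ C) {r N₁ N₂ : ℕ}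
    (h₁ : ∀ u, (G.WR C S₁ ρ₁ r u).ncard ≤ N₁)
    (h₂ : ∀ K, G.IsComp (C \ S₁) K → G.HasHittingSet F K r N₂) :
    G.HasHittingSet F C r (N₁ + N₂) := by
  obtain ⟨S, ρ, hSC, hS1, hW1, hK⟩ := exists_extension (G := G) (ρ₁ := ρ₁) hS₁ (Q := fun K S ρ =>
    (∀ f ∈ F, f ⊆ K → (f ∩ S).Nonempty) ∧ ∀ u, (G.WR K S ρ r u).ncard ≤ N₂) h₂
  refine ⟨S, ρ, hSC, fun f hf hfC => ?_, fun u => ?_⟩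
  · by_cases hfS : (f ∩ S₁).Nonempty
    · exact hfS.mono (Set.inter_subset_inter_right _ hS1)
    · have hsub : f ⊆ C \ S₁ := fun x hx => ⟨hfC hx, fun hxS => hfS ⟨x, hx, hxS⟩⟩
      obtain ⟨K, hKc, hfK⟩ := (hF f hf).exists_isComp_superset hsub
      obtain ⟨SK, ρK, ⟨hhit, -⟩, hSK, -⟩ := hK K hKc
      refine (hhit f hf hfK).mono (Set.inter_subset_inter_right _ ?_)
      rw [← hSK]; exact Set.inter_subset_left
  · by_cases hu1 : u ∈ S₁
    · exact ((Set.ncard_le_ncard (hW1 u hu1 r)).trans (h₁ u)).trans (Nat.le_add_right _ _)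
    · by_cases huC : u ∈ C
      · obtain ⟨K, hKc, huK⟩ := exists_isComp (G := G) (A := C \ S₁) ⟨huC, hu1⟩
        obtain ⟨SK, ρK, ⟨-, hcard⟩, -, hsub⟩ := hK K hKc
        calc _ ≤ _ := Set.ncard_le_ncard (hsub u huK r)
          _ ≤ _ := Set.ncard_union_le _ _
          _ ≤ _ := Nat.add_le_add (h₁ u) (hcard u)
      · have : G.WR C S ρ r u = ∅ :=
          Set.eq_empty_of_forall_notMem fun v hv => huC (mem_of_mem_WR hv)
        simp [this]

/-- Let `D` be attached, inside `C`, only to a connected set `K` that avoids `S`. Removing `D` from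
`S` does not enlarge reachable sets: an excursion through `D` can be replaced by a free one
through `K`. -/
theorem WR_diff_subset {C S K D : Set V} {ρ : V → ℕ} {r : ℕ} (hKC : K ⊆ C) (hK : G.ConnSet K)
    (hKS : Disjoint K S) (hD : ∀ a ∈ D, ∀ b ∈ C, G.Adj a b → b ∈ D ∪ K) (u : V) :
    ∃ u', G.WR C (S \ D) ρ r u ⊆ G.WR C S ρ r u' := by
  have key : ∀ t v n a, t = ρ v → v ∈ S \ D →
      G.Tour (S \ D) {w | w ∈ C ∧ (w ∈ S \ D → t ≤ ρ w)} n a v →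
      (a ∉ D → G.Tour S {w | w ∈ C ∧ (w ∈ S → t ≤ ρ w)} n a v) ∧
      (a ∈ D → ∀ k ∈ K, G.Tour S {w | w ∈ C ∧ (w ∈ S → t ≤ ρ w)} n k v) := by
    intro t v n a htv hv ht
    have hKA : K ⊆ {w | w ∈ C ∧ (w ∈ S → t ≤ ρ w)} := fun w hw =>
      ⟨hKC hw, fun hwS => absurd hwS (Set.disjoint_left.1 hKS hw)⟩
    induction ht with
    | single ha h1 =>
      exact ⟨fun _ => Tour.single ⟨ha.1, fun _ => htv.le⟩ fun _ => h1 hv, fun h => absurd h hv.2⟩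
    | @step n m a b c ha hab ht hmn h1 ih =>
      have ih := ih htv hv
      constructor
      · intro haD
        by_cases hbD : b ∈ D
        · have haK : a ∈ K := (hD b hbD a ha.1 hab.symm).resolve_left haD
          exact (ih.2 hbD a haK).mono subset_rfl subset_rfl hmn
        · exact Tour.step ⟨ha.1, fun haS => ha.2 ⟨haS, haD⟩⟩ hab (ih.1 hbD) hmn
            fun haS => h1 ⟨haS, haD⟩
      · intro haD k hk
        by_cases hbD : b ∈ D
        · exact (ih.2 hbD k hk).mono subset_rfl subset_rfl hmn
        · have hbK : b ∈ K := (hD a haD b ht.start_mem.1 hab).resolve_left hbD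
          exact ((ih.1 hbD).move_start hK hKA hKS hbK hk).mono subset_rfl subset_rfl hmn
  by_cases huD : u ∈ D
  · obtain ⟨k, hk⟩ := hK.1
    exact ⟨k, fun v hv => ⟨hv.1.1, (key _ v r u rfl hv.1 hv.2).2 huD k hk⟩⟩
  · exact ⟨u, fun v hv => ⟨hv.1.1, (key _ v r u rfl hv.1 hv.2).1 huD⟩⟩

end Reach

/-! ### Models whose branch sets contain members of a family -/

/-- A model of `Y` in `G` whose branch sets lie in `C` and each contain a member of `F`. -/
def RichModel {V W : Type*} (G : SimpleGraph V) (F : Set (Set V)) (Y : SimpleGraph W)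
    (C : Set V) : Prop :=
  ∃ B : W → Set V, (∀ x, B x ⊆ C ∧ G.ConnSet (B x) ∧ ∃ f ∈ F, f ⊆ B x) ∧
    (∀ x y, x ≠ y → Disjoint (B x) (B y)) ∧ ∀ x y, Y.Adj x y → G.Touches (B x) (B y)

/-! ### Packing and covering connected sets in a tree decomposition -/

section ErdosPosa

/-- A tree rooted at `root`: every edge joins a vertex to its parent. -/
theorem IsTree.exists_parent {N : Type*} {T : SimpleGraph N} (hT : T.IsTree) (root : N) :
    ∃ p : N → N, ∀ a b, T.Adj a b →
      (T.dist root a = T.dist root b + 1 ∧ p a = b) ∨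
        (T.dist root b = T.dist root a + 1 ∧ p b = a) := by
  choose P hP using fun a => hT.connected.exists_walk_length_eq_dist a root
  have key : ∀ a b, T.Adj a b → T.dist root a = T.dist root b + 1 → (P a).snd = b := by
    intro a b hab hd
    have h1 : (P a).IsPath := Walk.isPath_of_length_eq_dist _ (hP a)
    have h2 : (Walk.cons hab (P b)).IsPath := by
      refine Walk.isPath_of_length_eq_dist _ ?_
      rw [Walk.length_cons, hP b, dist_comm, ← hd, dist_comm]
    have := congrArg Subtype.val 
      ((hT.isAcyclic.subsingleton_path a root).elim ⟨P a, h1⟩ ⟨_, h2⟩)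
    simp only at this
    rw [this, Walk.snd_cons]
  refine ⟨fun a => (P a).snd, fun a b hab => ?_⟩
  rcases hT.dist_eq_dist_add_one_of_adj root hab with h | h
  · exact Or.inl ⟨h, key a b hab h⟩
  · exact Or.inr ⟨h, key b a hab.symm h⟩

/-- In a rooted tree, if two connected sets intersect and the top vertex `x` of the first is at
least as deep as that of the second, then `x` lies in the second set as well. -/
theorem ConnSet.top_mem {N : Type*} {T : SimpleGraph N} {d : N → ℕ} {p : N → N}
    (hp : ∀ a b, T.Adj a b → (d a = d b + 1 ∧ p a = b) ∨ (d b = d a + 1 ∧ p b = a))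
    {A B : Set N} (hA : T.ConnSet A) (hB : T.ConnSet B) {x y z : N} (hx : x ∈ A) (hy : y ∈ B)
    (hxmin : ∀ w ∈ A, d x ≤ d w) (hymin : ∀ w ∈ B, d y ≤ d w) (hyx : d y ≤ d x)
    (hzA : z ∈ A) (hzB : z ∈ B) : x ∈ B := by
  -- climbing from any vertex of a connected set to its top stays inside the set
  have key : ∀ (A : Set N) (x : N), T.ConnSet A → x ∈ A → (∀ w ∈ A, d x ≤ d w) → ∀ z ∈ A,
      (∀ i, i + d x ≤ d z → p^[i] z ∈ A) ∧ p^[d z - d x] z = x := by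
    intro A x hA hx hmin
    have := hA.2 {z ∈ A | (∀ i, i + d x ≤ d z → p^[i] z ∈ A) ∧ p^[d z - d x] z = x}
      (fun _ h => h.1) ⟨x, hx, fun i hi => by
        have : i = 0 := by omega
        subst this; simpa using hx, by simp⟩ (by
      rintro a ⟨haA, h1, h2⟩ b hb hab
      refine ⟨hb, ?_⟩
      have hmb := hmin b hb
      have hma := hmin a haA
      rcases hp a b hab with ⟨hd, hpa⟩ | ⟨hd, hpb⟩
      · constructor
        · intro i hi
          have := h1 (i + 1) (by omega)
          rwa [Function.iterate_succ_apply, hpa] at this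
        · have : d a - d x = (d b - d x) + 1 := by omega
          rwa [this, Function.iterate_succ_apply, hpa] at h2
      · constructor
        · rintro (_ | i) hi
          · simpa using hb
          · rw [Function.iterate_succ_apply, hpb]
            exact h1 i (by omega)
        · have : d b - d x = (d a - d x) + 1 := by omega
          rwa [this, Function.iterate_succ_apply, hpb])
    exact fun z hz => (this hz).2
  have h1 := key A x hA hx hxmin z hzA
  have h2 := key B y hB hy hymin z hzB
  rw [← h1.2]
  have := hxmin z hzA
  exact h2.1 _ (by omega)

variable {V : Type*} {G : SimpleGraph V}

theorem TreeDecomposition.connSet_nodes (D : G.TreeDecomposition) {f : Set V} (hf : G.ConnSet f) :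
    D.tree.ConnSet {x | (f ∩ D.bag x).Nonempty} := by
  have hu : ∀ u, D.tree.ConnSet {x | u ∈ D.bag x} :=
    fun u => connSet_iff_induce_connected.2 (D.connected_of_mem u)
  have hsub : ∀ u ∈ f, {x | u ∈ D.bag x} ⊆ {x | (f ∩ D.bag x).Nonempty} :=
    fun u huf x hx => ⟨u, huf, hx⟩
  obtain ⟨v, hv⟩ := hf.1
  refine ⟨(hu v).1.mono (hsub v hv), fun A hA hne hcl => ?_⟩
  obtain ⟨x, hx⟩ := hne
  obtain ⟨u, huf, hux⟩ := hA hx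
  have := hf.2 {w ∈ f | {x | w ∈ D.bag x} ⊆ A} (fun _ h => h.1)
    ⟨u, huf, (hu u).subset_of_closedIn (hsub u huf) hcl ⟨x, hux, hx⟩⟩ (by
      rintro a ⟨haf, haA⟩ b hb hab
      obtain ⟨y, hay, hby⟩ := D.exists_bag_of_adj a b hab
      exact ⟨hb, (hu b).subset_of_closedIn (hsub b hb) hcl ⟨y, hby, haA hay⟩⟩)
  rintro y ⟨w, hwf, hwy⟩
  exact (this hwf).2 hwy

/-- The Erdős–Pósa property of connected sets in graphs of bounded treewidth: the bag at the
deepest top node of a member meets every member that intersects it. -/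
theorem TreeDecomposition.exists_hitting_set [Finite V] (D : G.TreeDecomposition) {w : ℕ}
    (hw : ∀ x, (D.bag x).ncard ≤ w) (d : ℕ) (F : Set (Set V)) (hF : ∀ f ∈ F, G.ConnSet f)
    (hd : ¬ ∃ g : Fin d → Set V, (∀ i, g i ∈ F) ∧ ∀ i j, i ≠ j → Disjoint (g i) (g j)) :
    ∃ S : Set V, S.ncard ≤ d * w ∧ ∀ f ∈ F, (f ∩ S).Nonempty := by
  have := D.finite_node
  obtain ⟨root⟩ := D.isTree.connected.nonempty
  have : Nonempty D.node := ⟨root⟩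
  obtain ⟨p, hp⟩ := D.isTree.exists_parent root
  have htop : ∀ f, G.ConnSet f → ∃ x, (f ∩ D.bag x).Nonempty ∧
      ∀ y, (f ∩ D.bag y).Nonempty → D.tree.dist root x ≤ D.tree.dist root y := by
    intro f hf
    obtain ⟨x, hx, hmin⟩ := Set.exists_min_image {x | (f ∩ D.bag x).Nonempty} (D.tree.dist root)
      (Set.toFinite _) (D.connSet_nodes hf).1
    exact ⟨x, hx, hmin⟩
  choose! top htop1 htop2 using htop
  induction d generalizing F with
  | zero => exact absurd ⟨Fin.elim0, fun i => i.elim0, fun i => i.elim0⟩ hd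
  | succ d ih =>
    rcases F.eq_empty_or_nonempty with rfl | hne
    · exact ⟨∅, by simp, by simp⟩
    obtain ⟨f, hf, hmax⟩ := Set.exists_max_image F (fun f => D.tree.dist root (top f))
      (Set.toFinite _) hne
    obtain ⟨S, hS, hhit⟩ := ih {f' ∈ F | ¬ (f' ∩ D.bag (top f)).Nonempty}
        (fun f' h => hF f' h.1) (by
      rintro ⟨g, hg, hdisj⟩
      have hfg : ∀ i, Disjoint f (g i) := by
        intro i
        by_contra hcon
        obtain ⟨v, hvf, hvg⟩ := Set.not_disjoint_iff.1 hcon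
        obtain ⟨z, hz⟩ := (connSet_iff_induce_connected.2 (D.connected_of_mem v)).1
        exact (hg i).2 ((D.connSet_nodes (hF f hf)).top_mem hp (D.connSet_nodes (hF _ (hg i).1))
          (htop1 f (hF f hf)) (htop1 _ (hF _ (hg i).1)) (htop2 f (hF f hf))
          (htop2 _ (hF _ (hg i).1)) (hmax _ (hg i).1) ⟨v, hvf, hz⟩ ⟨v, hvg, hz⟩)
      refine hd ⟨Fin.cons f g, Fin.cases hf fun i => (hg i).1, ?_⟩
      refine Fin.cases (Fin.cases (fun h => absurd rfl h) fun j _ => ?_)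
        fun i => Fin.cases (fun _ => ?_) fun j hij => ?_
      · simpa using hfg j
      · simpa using (hfg i).symm
      · simpa using hdisj i j (fun h => hij (by rw [h])))
    refine ⟨S ∪ D.bag (top f), ?_, fun f' hf' => ?_⟩
    · calc _ ≤ S.ncard + (D.bag (top f)).ncard := Set.ncard_union_le _ _
        _ ≤ d * w + w := Nat.add_le_add hS (hw _)
        _ = (d + 1) * w := by ring
    · by_cases h : (f' ∩ D.bag (top f)).Nonempty
      · exact h.mono (Set.inter_subset_inter_right _ Set.subset_union_right)
      · exact (hhit f' ⟨hf', h⟩).mono (Set.inter_subset_inter_right _ Set.subset_union_left)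

/-- Excluding rich models of an edgeless graph means bounding the number of disjoint members of
the family. -/
theorem TreeDecomposition.exists_hitting_set_of_not_richModel_bot [Finite V]
    (D : G.TreeDecomposition) {w : ℕ} (hw : ∀ x, (D.bag x).ncard ≤ w) {W : Type*} [Finite W]
    {Y : SimpleGraph W} (hY : Y = ⊥) {F : Set (Set V)} (hF : ∀ f ∈ F, G.ConnSet f) {C : Set V}
    (h : ¬ G.RichModel F Y C) :
    ∃ S ⊆ C, S.ncard ≤ Nat.card W * w ∧ ∀ f ∈ F, f ⊆ C → (f ∩ S).Nonempty := by
  obtain ⟨S, hS, hhit⟩ := D.exists_hitting_set hw (Nat.card W) {f ∈ F | f ⊆ C}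
    (fun f hf => hF f hf.1) (by
      rintro ⟨g, hg, hdisj⟩
      have e := Finite.equivFin W
      refine h ⟨fun x => g (e x), fun x => ⟨(hg _).2, hF _ (hg _).1, _, (hg _).1, subset_rfl⟩,
        fun x y hxy => hdisj _ _ (e.injective.ne hxy), ?_⟩
      subst hY
      exact fun x y hxy => absurd hxy (by simp))
  refine ⟨S ∩ C, Set.inter_subset_right,
    (Set.ncard_le_ncard Set.inter_subset_left).trans hS, fun f hf hfC => ?_⟩
  obtain ⟨v, hvf, hvS⟩ := hhit f ⟨hf, hfC⟩
  exact ⟨v, hvf, hvS, hfC hvf⟩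

end ErdosPosa

/-! ### Towers -/

/-- Adjacency in `tower Y`. -/
inductive TowerAdj {W : Type*} (Y : SimpleGraph W) : List W → List W → Prop
  | down (y : W) : TowerAdj Y [] [y]
  | up (y : W) : TowerAdj Y [y] []
  | sibling {y y' : W} : Y.Adj y y' → TowerAdj Y [y] [y']
  | cons (y : W) {l l' : List W} : TowerAdj Y l l' → TowerAdj Y (y :: l) (y :: l')

/-- The tower over `Y`: the vertices are the words in the vertices of `Y`, and the one-letter
extensions of each word `l` induce a copy of `Y` all of whose vertices are joined to `l`. -/
def tower {W : Type*} (Y : SimpleGraph W) : SimpleGraph (List W) where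
  Adj := TowerAdj Y
  symm := ⟨fun _ _ h => by
    induction h with
    | down y => exact .up y
    | up y => exact .down y
    | sibling h => exact .sibling h.symm
    | cons y _ ih => exact .cons y ih⟩
  loopless := ⟨fun l h => by
    induction l with
    | nil => cases h
    | cons y l ih =>
      cases h with
      | sibling h => exact h.ne rfl
      | cons _ h => exact ih h⟩

/-- Disjoint copies of `Y`, one for each element of `I`. -/
def copies {W : Type*} (Y : SimpleGraph W) (I : Type*) : SimpleGraph (W × I) where
  Adj p q := Y.Adj p.1 q.1 ∧ p.2 = q.2
  symm := ⟨fun _ _ h => ⟨h.1.symm, h.2.symm⟩⟩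
  loopless := ⟨fun _ h => h.1.ne rfl⟩

/-- A rich model of the part of `tower Y` formed by the words of length at most `h`, given
recursively: `D` is the branch set of the empty word, all branch sets lie in the connected
container `C`, and the subtowers above distinct one-letter words have disjoint containers. -/
def RootedTower {V W : Type*} (G : SimpleGraph V) (F : Set (Set V)) (Y : SimpleGraph W) :
    ℕ → Set V → Set V → Prop
  | 0, D, C => G.ConnSet D ∧ D ⊆ C ∧ G.ConnSet C ∧ ∃ f ∈ F, f ⊆ D
  | h + 1, D, C => (G.ConnSet D ∧ D ⊆ C ∧ G.ConnSet C ∧ ∃ f ∈ F, f ⊆ D) ∧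
      ∃ Dc Cc : W → Set V, (∀ y, RootedTower G F Y h (Dc y) (Cc y)) ∧
        (∀ y, Cc y ⊆ C ∧ Disjoint (Cc y) D ∧ G.Touches D (Dc y)) ∧
        (∀ y y', y ≠ y' → Disjoint (Cc y) (Cc y')) ∧
        ∀ y y', Y.Adj y y' → G.Touches (Dc y) (Dc y')

/-- `C` contains a rich model of the part of `tower Y` of height `h`. -/
def HasTower {V W : Type*} (G : SimpleGraph V) (F : Set (Set V)) (Y : SimpleGraph W) (h : ℕ)
    (C : Set V) : Prop :=
  ∃ D C', C' ⊆ C ∧ G.RootedTower F Y h D C'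

section Towers

variable {V W W' : Type*} {G : SimpleGraph V} {F : Set (Set V)} {Y : SimpleGraph W}
  {Y' : SimpleGraph W'}

theorem RootedTower.base {h : ℕ} {D C : Set V} (hT : G.RootedTower F Y h D C) :
    G.ConnSet D ∧ D ⊆ C ∧ G.ConnSet C ∧ ∃ f ∈ F, f ⊆ D := by
  cases h with
  | zero => exact hT
  | succ h => exact hT.1

theorem RootedTower.mono {h : ℕ} {D C C' : Set V} (hT : G.RootedTower F Y h D C) (hC : C ⊆ C')
    (hC' : G.ConnSet C') : G.RootedTower F Y h D C' := by
  cases h with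
  | zero => exact ⟨hT.1, hT.2.1.trans hC, hC', hT.2.2.2⟩
  | succ h =>
    obtain ⟨hb, Dc, Cc, h1, h2, h3⟩ := hT
    exact ⟨⟨hb.1, hb.2.1.trans hC, hC', hb.2.2.2⟩, Dc, Cc, h1,
      fun y => ⟨(h2 y).1.trans hC, (h2 y).2⟩, h3⟩

theorem RootedTower.comap (φ : Copy Y Y') {h : ℕ} {D C : Set V} (hT : G.RootedTower F Y' h D C) :
    G.RootedTower F Y h D C := by
  induction h generalizing D C with
  | zero => exact hT
  | succ h ih =>
    obtain ⟨hb, Dc, Cc, h1, h2, h3, h4⟩ := hT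
    exact ⟨hb, fun y => Dc (φ y), fun y => Cc (φ y), fun y => ih (h1 _), fun y => h2 _,
      fun y y' hy => h3 _ _ (φ.injective.ne hy), fun y y' hy => h4 _ _ (φ.toHom.map_adj hy)⟩

theorem HasTower.subset {h : ℕ} {C C' : Set V} (hT : G.HasTower F Y h C) (hC : C ⊆ C') :
    G.HasTower F Y h C' := by
  obtain ⟨D, C₀, hC₀, hT⟩ := hT
  exact ⟨D, C₀, hC₀.trans hC, hT⟩

theorem HasTower.exists_mem {h : ℕ} {C : Set V} (hT : G.HasTower F Y h C) : ∃ f ∈ F, f ⊆ C := by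
  obtain ⟨D, C₀, hC₀, hT⟩ := hT
  obtain ⟨-, hDC, -, f, hf, hfD⟩ := hT.base
  exact ⟨f, hf, hfD.trans (hDC.trans hC₀)⟩

theorem hasTower_zero {C f : Set V} (hf : f ∈ F) (hfc : G.ConnSet f) (hfC : f ⊆ C) :
    G.HasTower F Y 0 C :=
  ⟨f, f, hfC, hfc, subset_rfl, hfc, f, hf, subset_rfl⟩

theorem RootedTower.exists_branchSets {h : ℕ} {D C : Set V} (hT : G.RootedTower F Y h D C) :
    ∃ B : List W → Set V, B [] = D ∧
      (∀ l, l.length ≤ h → B l ⊆ C ∧ G.ConnSet (B l) ∧ ∃ f ∈ F, f ⊆ B l) ∧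
      (∀ l l', l.length ≤ h → l'.length ≤ h → l ≠ l' → Disjoint (B l) (B l')) ∧
      ∀ l l', l.length ≤ h → l'.length ≤ h → (tower Y).Adj l l' → G.Touches (B l) (B l') := by
  induction h generalizing D C with
  | zero =>
    refine ⟨fun _ => D, rfl, fun l _ => ⟨hT.2.1, hT.1, hT.2.2.2⟩, ?_, ?_⟩
    · intro l l' hl hl' hne
      exact absurd ((List.length_eq_zero_iff.1 (by omega)).trans
        (List.length_eq_zero_iff.1 (by omega : l'.length = 0)).symm) hne
    · intro l l' hl hl' hadj
      rw [List.length_eq_zero_iff.1 (by omega : l.length = 0),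
        List.length_eq_zero_iff.1 (by omega : l'.length = 0)] at hadj
      exact absurd hadj ((tower Y).loopless.irrefl _)
  | succ h ih =>
    obtain ⟨hb, Dc, Cc, h1, h2, h3, h4⟩ := hT
    choose Bc hnil hB hdisj hadj using fun y => ih (h1 y)
    refine ⟨fun l => match l with | [] => D | y :: l => Bc y l, rfl, ?_, ?_, ?_⟩
    · rintro (_ | ⟨y, l⟩) hl
      · exact ⟨hb.2.1, hb.1, hb.2.2.2⟩
      · have := hB y l (by simpa using hl)
        exact ⟨this.1.trans (h2 y).1, this.2⟩
    · rintro (_ | ⟨y, l⟩) (_ | ⟨y', l'⟩) hl hl' hne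
      · exact absurd rfl hne
      · exact ((h2 y').2.1.mono_left (hB y' l' (by simpa using hl')).1).symm
      · exact (h2 y).2.1.mono_left (hB y l (by simpa using hl)).1
      · by_cases hy : y = y'
        · subst hy
          exact hdisj y l l' (by simpa using hl) (by simpa using hl') fun h => hne (by rw [h])
        · exact (h3 y y' hy).mono (hB y l (by simpa using hl)).1 (hB y' l' (by simpa using hl')).1
    · intro l l' hl hl' hll
      cases hll with
      | down y => simpa [hnil] using (h2 y).2.2
      | up y => simpa [hnil] using (h2 y).2.2.symm
      | sibling hyy => simpa [hnil] using h4 _ _ hyy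
      | cons y hll => exact hadj y _ _ (by simpa using hl) (by simpa using hl') hll

theorem HasTower.richModel {h : ℕ} {C : Set V} (hT : G.HasTower F Y h C) {X : SimpleGraph W'}
    (φ : Copy X (tower Y)) (hφ : ∀ x, (φ x).length ≤ h) : G.RichModel F X C := by
  obtain ⟨D, C', hC', hT⟩ := hT
  obtain ⟨B, -, h1, h2, h3⟩ := hT.exists_branchSets
  exact ⟨fun x => B (φ x), fun x => ⟨(h1 _ (hφ x)).1.trans hC', (h1 _ (hφ x)).2⟩,
    fun x y hxy => h2 _ _ (hφ x) (hφ y) (φ.injective.ne hxy),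
    fun x y hxy => h3 _ _ (hφ x) (hφ y) (φ.toHom.map_adj hxy)⟩

/-- Disjoint connected subsets of a connected set can be enlarged to a partition of it into
connected sets. -/
theorem ConnSet.exists_partition [Finite V] {B : Set V} (hB : G.ConnSet B) {ι : Type*}
    [Nonempty ι] (A : ι → Set V) (hA : ∀ i, G.ConnSet (A i) ∧ A i ⊆ B)
    (hdisj : ∀ i j, i ≠ j → Disjoint (A i) (A j)) :
    ∃ A' : ι → Set V, (∀ i, A i ⊆ A' i ∧ G.ConnSet (A' i) ∧ A' i ⊆ B) ∧
      (∀ i j, i ≠ j → Disjoint (A' i) (A' j)) ∧ B ⊆ ⋃ i, A' i := by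
  classical
  induction hn : (B \ ⋃ i, A i).ncard using Nat.strong_induction_on generalizing A with
  | _ n ih =>
  by_cases hcov : B ⊆ ⋃ i, A i
  · exact ⟨A, fun i => ⟨subset_rfl, hA i⟩, hdisj, hcov⟩
  have hncl : ¬ G.ClosedIn (⋃ i, A i) B := by
    intro hcl
    obtain ⟨i⟩ := ‹Nonempty ι›
    obtain ⟨a, ha⟩ := (hA i).1.1
    exact hcov (hB.2 _ (Set.iUnion_subset fun i => (hA i).2) ⟨a, Set.mem_iUnion.2 ⟨i, ha⟩⟩ hcl)
  simp only [ClosedIn, not_forall] at hncl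
  obtain ⟨a, ha, b, hb, hab, hbA⟩ := hncl
  obtain ⟨i, hai⟩ := Set.mem_iUnion.1 ha
  have hbA' : ∀ j, b ∉ A j := fun j hj => hbA (Set.mem_iUnion.2 ⟨j, hj⟩)
  have hsub : ∀ j, A j ⊆ Function.update A i (A i ∪ {b}) j := by
    intro j
    by_cases hj : j = i
    · subst hj; simp
    · simp [hj]
  obtain ⟨A', h1, h2, h3⟩ := ih _ (by
      rw [← hn]
      refine Set.ncard_lt_ncard (Set.ssubset_iff_of_subset ?_ |>.2 ⟨b, ⟨hb, hbA⟩, ?_⟩)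
      · exact Set.sdiff_subset_sdiff_right (Set.iUnion_mono hsub)
      · exact fun h => h.2 (Set.mem_iUnion.2 ⟨i, by simp⟩))
    (Function.update A i (A i ∪ {b})) (by
      intro j
      by_cases hj : j = i
      · subst hj
        simp only [Function.update_self]
        exact ⟨(hA j).1.union (ConnSet.singleton b) (Or.inr ⟨a, hai, b, rfl, hab⟩),
          Set.union_subset (hA j).2 (by simpa using hb)⟩
      · simpa [hj] using hA j) (by
      intro j k hjk
      by_cases hj : j = i
      · subst hj
        simpa [Ne.symm hjk, hbA'] using hdisj j k hjk
      · by_cases hk : k = i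
        · subst hk
          simpa [hj, hbA'] using hdisj j k hjk
        · simpa [hj, hk] using hdisj j k hjk) rfl
  exact ⟨A', fun j => ⟨(hsub j).trans (h1 j).1, (h1 j).2⟩, h2, h3⟩

/-- If every layer of a tower consists of more than `A.ncard` copies of `Y`, then one of the copies
next to the root avoids `A`; everything else can be contracted into a new root that contains
`A`. -/
theorem HasTower.reroot [Finite V] {m h : ℕ} {B A : Set V} (hB : G.ConnSet B)
    (hT : G.HasTower F (Y.copies (Fin m)) h B) (hAB : A ⊆ B) (hA : A.ncard < m) :
    ∃ D, G.RootedTower F Y h D B ∧ A ⊆ D := by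
  have hcopy : ∀ i : Fin m, Nonempty (Copy Y (Y.copies (Fin m))) := fun i =>
    ⟨⟨⟨fun y => (y, i), fun h => ⟨h, rfl⟩⟩, fun y y' hyy => congrArg Prod.fst hyy⟩⟩
  obtain ⟨D₀, C₀, hC₀, hT⟩ := hT
  cases h with
  | zero =>
    obtain ⟨-, hDC, -, f, hf, hfD⟩ := hT
    exact ⟨B, ⟨hB, subset_rfl, hB, f, hf, hfD.trans (hDC.trans hC₀)⟩, hAB⟩
  | succ h =>
    obtain ⟨⟨hD₀, hDC, -, f, hf, hfD⟩, Dc, Cc, h1, h2, h3, h4⟩ := hT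
    obtain ⟨P, hP1, hP2, hP3⟩ := hB.exists_partition
      (fun j : Option (W × Fin m) => j.elim D₀ Cc) (by
        rintro (_ | p)
        · exact ⟨hD₀, hDC.trans hC₀⟩
        · exact ⟨(h1 p).base.2.2.1, (h2 p).1.trans hC₀⟩) (by
        rintro (_ | p) (_ | q) hne
        · exact absurd rfl hne
        · exact (h2 q).2.1.symm
        · exact (h2 p).2.1
        · exact h3 p q fun h => hne (by rw [h]))
    have hPD : D₀ ⊆ P none := (hP1 none).1
    have hPC : ∀ p, Cc p ⊆ P (some p) := fun p => (hP1 (some p)).1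
    obtain ⟨i, hi⟩ : ∃ i : Fin m, ∀ y, Disjoint (P (some (y, i))) A := by
      by_contra hcon
      push Not at hcon
      choose y hy using hcon
      choose a ha using fun i => Set.not_disjoint_iff.1 (hy i)
      have hinj : Function.Injective a := by
        intro i j hij
        by_contra hne
        refine Set.disjoint_left.1 (hP2 (some (y i, i)) (some (y j, j)) ?_) (ha i).1
          (hij ▸ (ha j).1)
        simp [hne]
      have : m ≤ A.ncard := by
        calc m = (Set.range a).ncard := by
              rw [← Set.image_univ, Set.ncard_image_of_injective _ hinj, Set.ncard_univ,
                Nat.card_eq_fintype_card, Fintype.card_fin]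
          _ ≤ A.ncard := Set.ncard_le_ncard (by rintro _ ⟨i, rfl⟩; exact (ha i).2)
      omega
    obtain ⟨φ⟩ := hcopy i
    have hDconn : G.ConnSet (P none ∪ ⋃ q : {p : W × Fin m // p.2 ≠ i}, P (some q)) :=
      (hP1 none).2.1.union_iUnion (fun q => (hP1 _).2.1)
        fun q => (h2 q).2.2.mono hPD ((h1 q).base.2.1.trans (hPC q))
    refine ⟨_, ⟨⟨hDconn, Set.union_subset (hP1 none).2.2 (Set.iUnion_subset fun q => (hP1 _).2.2),
      hB, f, hf, hfD.trans (hPD.trans Set.subset_union_left)⟩, fun y => Dc (y, i),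
      fun y => P (some (y, i)), fun y => ?_, fun y => ⟨(hP1 _).2.2, ?_, ?_⟩, ?_, ?_⟩, ?_⟩
    · exact ((h1 (y, i)).comap φ).mono (hPC _) (hP1 _).2.1
    · rw [Set.disjoint_union_right, Set.disjoint_iUnion_right]
      refine ⟨hP2 _ _ (by simp), fun q => hP2 _ _ fun h => q.2 ?_⟩
      rw [← Option.some_injective _ h]
    · exact (h2 (y, i)).2.2.mono (hPD.trans Set.subset_union_left) subset_rfl
    · intro y y' hyy
      exact hP2 _ _ (by simpa using hyy)
    · exact fun y y' hyy => h4 _ _ ⟨hyy, rfl⟩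
    · intro a ha
      obtain ⟨_ | ⟨y, j⟩, hj⟩ := Set.mem_iUnion.1 (hP3 (hAB ha))
      · exact Or.inl hj
      · refine Or.inr (Set.mem_iUnion.2 ⟨⟨(y, j), ?_⟩, hj⟩)
        rintro rfl
        exact Set.disjoint_left.1 (hi y) hj ha

/-- A connected root containing a member of `F`, together with a model of `Y` whose branch sets
touch the root and contain towers of height `h`, forms a tower of height `h + 1`. -/
theorem hasTower_succ [Finite V] [Finite W] {m h : ℕ} (hm : 2 * Nat.card W + 1 < m)
    {Z P : Set V} {B : W → Set V} (hP : G.ConnSet P) (hPZ : P ⊆ Z) (hPF : ∃ f ∈ F, f ⊆ P)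
    (hB : ∀ y, G.ConnSet (B y) ∧ B y ⊆ Z ∧ G.HasTower F (Y.copies (Fin m)) h (B y))
    (hPB : ∀ y, G.Touches P (B y) ∧ Disjoint (B y) P)
    (hdisj : ∀ y y', y ≠ y' → Disjoint (B y) (B y'))
    (hadj : ∀ y y', Y.Adj y y' → G.Touches (B y) (B y')) :
    G.HasTower F Y (h + 1) Z := by
  have : Nonempty V := ⟨hP.1.some⟩
  choose p hp a ha hpa using fun y => (hPB y).1
  choose! s hs t ht hst using hadj
  have hcard : ∀ g : W → V, (Set.range g).ncard ≤ Nat.card W := fun g => by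
    rw [← Set.image_univ, ← Set.ncard_univ]
    exact Set.ncard_image_le
  have hre : ∀ y, ∃ D, G.RootedTower F Y h D (B y) ∧
      (insert (a y) (Set.range (s y) ∪ Set.range (fun y' => t y' y))) ∩ B y ⊆ D := by
    intro y
    refine (hB y).2.2.reroot (hB y).1 Set.inter_subset_right ?_
    have h1 := Set.ncard_le_ncard (Set.inter_subset_left :
      (insert (a y) (Set.range (s y) ∪ Set.range (fun y' => t y' y))) ∩ B y ⊆ _)
    have h2 := Set.ncard_insert_le (a y) (Set.range (s y) ∪ Set.range (fun y' => t y' y))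
    have h3 := Set.ncard_union_le (Set.range (s y)) (Set.range (fun y' => t y' y))
    have h4 := hcard (s y)
    have h5 := hcard (fun y' => t y' y)
    omega
  choose D hD hsub using hre
  refine ⟨P, P ∪ ⋃ y, B y, Set.union_subset hPZ (Set.iUnion_subset fun y => (hB y).2.1),
    ⟨hP, Set.subset_union_left, hP.union_iUnion (fun y => (hB y).1) fun y => (hPB y).1, hPF⟩,
    D, B, hD, fun y => ⟨(Set.subset_iUnion B y).trans Set.subset_union_right, (hPB y).2, ?_⟩,
    hdisj, ?_⟩
  · exact ⟨p y, hp y, a y, hsub y ⟨Or.inl rfl, ha y⟩, hpa y⟩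
  · intro y y' hyy
    exact ⟨s y y', hsub y ⟨Or.inr (Or.inl ⟨y', rfl⟩), hs y y' hyy⟩, t y y',
      hsub y' ⟨Or.inr (Or.inr ⟨y, rfl⟩), ht y y' hyy⟩, hst y y' hyy⟩

end Towers

/-! ### Peeling off a hitting set next to a connected root -/

/-- The connected subsets of `C` that contain a tower and touch the root `Z \ C`. -/
def attachedTowers {V W : Type*} (G : SimpleGraph V) (F : Set (Set V)) (Y : SimpleGraph W) (h : ℕ)
    (Z C : Set V) : Set (Set V) :=
  {A | G.ConnSet A ∧ A ⊆ C ∧ G.HasTower F Y h A ∧ G.Touches A (Z \ C)}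

section Peel

variable {V W : Type*} {G : SimpleGraph V} {F : Set (Set V)} {Y : SimpleGraph W}

/-- A model of two copies of `Y` by sets that contain towers and touch the root yields a higher
tower: one branch set of the second copy is merged into the root, to put a member of `F` there. -/
theorem not_richModel_attachedTowers [Finite V] [Finite W] [Nonempty W] {m h : ℕ}
    (hm : 2 * Nat.card W + 1 < m) {Z C : Set V} (hCZ : C ⊆ Z) (hR : G.ConnSet (Z \ C))
    (hno : ¬ G.HasTower F Y (h + 1) Z) :
    ¬ G.RichModel (G.attachedTowers F (Y.copies (Fin m)) h Z C) (Y.copies (Fin 2)) C := by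
  rintro ⟨B, hB, hdisj, hadj⟩
  have hBR : ∀ p, G.Touches (Z \ C) (B p) := fun p => by
    obtain ⟨f, hf, hfB⟩ := (hB p).2.2
    exact hf.2.2.2.symm.mono subset_rfl hfB
  have hBT : ∀ p, G.HasTower F (Y.copies (Fin m)) h (B p) := fun p => by
    obtain ⟨f, hf, hfB⟩ := (hB p).2.2
    exact hf.2.2.1.subset hfB
  obtain ⟨y₀⟩ := ‹Nonempty W›
  refine hno (hasTower_succ hm (hR.union (hB (y₀, 1)).2.1 (Or.inr (hBR (y₀, 1)))) (B := fun y =>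
    B (y, 0)) (Set.union_subset Set.sdiff_subset ((hB _).1.trans hCZ)) ?_ (fun y => ⟨(hB _).2.1,
    (hB _).1.trans hCZ, hBT _⟩) (fun y => ⟨(hBR _).mono Set.subset_union_left subset_rfl, ?_⟩)
    (fun y y' hyy => hdisj _ _ (by simpa using hyy)) fun y y' hyy => hadj _ _ ⟨hyy, rfl⟩)
  · obtain ⟨f, hf, hfB⟩ := (hBT (y₀, 1)).exists_mem
    exact ⟨f, hf, hfB.trans Set.subset_union_right⟩
  · rw [Set.disjoint_union_right]
    exact ⟨Set.disjoint_left.2 fun x hx hx' => hx'.2 ((hB _).1 hx), hdisj _ _ (by simp)⟩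

/-- Let `S` hit every member of a family of connected subsets of `C` that touch the root `Z \ C`.
If `U` avoids `S` and the root, and `D` is attached only to `U`, then `S \ D` still hits every
member: on its way to the root a member that enters `D` has to leave `D ∪ U` through `S`. -/
theorem hits_diff {Z C S U D : Set V} {F' : Set (Set V)} (hCZ : C ⊆ Z)
    (hF' : ∀ f ∈ F', G.ConnSet f ∧ f ⊆ C ∧ G.Touches f (Z \ C))
    (hhit : ∀ f ∈ F', (f ∩ S).Nonempty) (hU : U ⊆ C \ S)
    (hUn : ∀ a ∈ U, ∀ b ∈ Z, G.Adj a b → b ∈ S ∪ U) (hS : S ⊆ C) (hD : D ⊆ C)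
    (hDn : ∀ a ∈ D, ∀ b ∈ Z, G.Adj a b → b ∈ D ∪ U) : ∀ f ∈ F', (f ∩ (S \ D)).Nonempty := by
  intro f hf
  by_contra hcon
  have hfS : ∀ x ∈ f, x ∈ S → x ∈ D := fun x hx hxS => by
    by_contra hxD
    exact hcon ⟨x, hx, hxS, hxD⟩
  obtain ⟨hfc, hfC, a, haf, b, hb, hab⟩ := hF' f hf
  have hsub := hfc.2 (f ∩ (D ∪ U)) Set.inter_subset_left (by
      obtain ⟨x, hx, hxS⟩ := hhit f hf
      exact ⟨x, hx, Or.inl (hfS x hx hxS)⟩) (by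
    rintro x ⟨hx, hxD | hxU⟩ y hy hxy
    · exact ⟨hy, hDn x hxD y (hCZ (hfC hy)) hxy⟩
    · rcases hUn x hxU y (hCZ (hfC hy)) hxy with hyS | hyU
      · exact ⟨hy, Or.inl (hfS y hy hyS)⟩
      · exact ⟨hy, Or.inr hyU⟩)
  rcases (hsub haf).2 with haD | haU
  · rcases hDn a haD b hb.1 hab with h | h
    · exact hb.2 (hD h)
    · exact hb.2 (hU h).1
  · rcases hUn a haU b hb.1 hab with h | h
    · exact hb.2 (hS h)
    · exact hb.2 (hU h).1

/-- A smallest hitting set with property `P` has parts away from the root whose deletion keeps `Z`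
connected, provided `P` survives the removal of what is cut off from the root by such a part. -/
theorem exists_peeling [Finite V] {Z C : Set V} (hZ : G.ConnSet Z) (hCZ : C ⊆ Z)
    (hR : G.ConnSet (Z \ C)) {F' : Set (Set V)}
    (hF' : ∀ f ∈ F', G.ConnSet f ∧ f ⊆ C ∧ G.Touches f (Z \ C)) (P : Set V → Prop)
    (hP : ∃ S ⊆ C, P S ∧ ∀ f ∈ F', (f ∩ S).Nonempty) :
    ∃ S ⊆ C, P S ∧ (∀ f ∈ F', (f ∩ S).Nonempty) ∧ ∀ U ⊆ C \ S,
      (∀ a ∈ U, ∀ b ∈ Z, G.Adj a b → b ∈ S ∪ U) →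
      (∀ D, (∀ a ∈ D, ∀ b ∈ C, G.Adj a b → b ∈ D ∪ U) → P (S \ D)) → G.ConnSet (Z \ U) := by
  obtain ⟨S, ⟨hSC, hPS, hhit⟩, hmin⟩ := Set.exists_min_image
    {S | S ⊆ C ∧ P S ∧ ∀ f ∈ F', (f ∩ S).Nonempty} Set.ncard (Set.toFinite _) hP
  refine ⟨S, hSC, hPS, hhit, fun U hU hUn hPU => ?_⟩
  refine hR.of_closedIn_empty (fun x hx => ⟨hx.1, fun hxU => hx.2 (hU hxU).1⟩) ?_
  intro D hD hDR hDcl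
  by_contra hne
  have hDC : D ⊆ C := fun x hx => by
    by_contra hxC
    exact Set.disjoint_left.1 hDR hx ⟨(hD hx).1, hxC⟩
  have hDn : ∀ a ∈ D, ∀ b ∈ Z, G.Adj a b → b ∈ D ∪ U := fun a ha b hb hab => by
    by_cases hbU : b ∈ U
    · exact Or.inr hbU
    · exact Or.inl (hDcl a ha b ⟨hb, hbU⟩ hab)
  -- otherwise `D` could not be attached to `U`, whose neighbours lie in `S ∪ U`
  have hDS : (D ∩ S).Nonempty := by
    by_contra hcon
    have hcl : G.ClosedIn D Z := by
      intro a ha b hb hab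
      refine (hDn a ha b hb hab).resolve_right fun hbU => ?_
      rcases hUn b hbU a (hD ha).1 hab.symm with h | h
      · exact hcon ⟨a, ha, h⟩
      · exact (hD ha).2 h
    have := hZ.2 D (hD.trans Set.sdiff_subset) (Set.nonempty_iff_ne_empty.2 hne) hcl
    obtain ⟨x, hx⟩ := hR.1
    exact hx.2 (hDC (this hx.1))
  have hle := hmin (S \ D) ⟨Set.sdiff_subset.trans hSC,
    hPU D fun a ha b hb hab => hDn a ha b (hCZ hb) hab,
    hits_diff hCZ hF' hhit hU hUn hSC hDC hDn⟩
  obtain ⟨x, hxD, hxS⟩ := hDS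
  have hlt : (S \ D).ncard < S.ncard := Set.ncard_lt_ncard
    (Set.ssubset_iff_of_subset Set.sdiff_subset |>.2 ⟨x, hxS, fun h => h.2 hxD⟩)
  omega

/-- A component left by a hitting set of the attached towers that still contains a tower is
separated from the root. -/
theorem IsComp.not_touches_root {Z C S K : Set V} {h : ℕ}
    (hhit : ∀ f ∈ G.attachedTowers F Y h Z C, (f ∩ S).Nonempty) (hK : G.IsComp (C \ S) K)
    (hT : G.HasTower F Y h K) :
    ¬ G.Touches K (Z \ C) ∧ ∀ a ∈ K, ∀ b ∈ Z, G.Adj a b → b ∈ S ∪ K := by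
  have hKC : K ⊆ C := hK.1.trans Set.sdiff_subset
  have hnot : ¬ G.Touches K (Z \ C) := by
    intro htouch
    obtain ⟨x, hxK, hxS⟩ := hhit K ⟨hK.2.1, hKC, hT, htouch⟩
    exact (hK.1 hxK).2 hxS
  refine ⟨hnot, fun a ha b hb hab => ?_⟩
  by_cases hbC : b ∈ C
  · by_cases hbS : b ∈ S
    · exact Or.inl hbS
    · exact Or.inr (hK.2.2 a ha b ⟨hbC, hbS⟩ hab)
  · exact absurd ⟨a, ha, b, ⟨hb, hbC⟩, hab⟩ hnot

theorem IsComp.ncard_lt_of_not_touches [Finite V] {Z C S K : Set V} (hZ : G.ConnSet Z)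
    (hCZ : C ⊆ Z) (hR : (Z \ C).Nonempty) (hK : G.IsComp (C \ S) K)
    (hKR : ¬ G.Touches K (Z \ C)) : K.ncard < C.ncard := by
  have hKC : K ⊆ C := hK.1.trans Set.sdiff_subset
  refine Set.ncard_lt_ncard (hKC.ssubset_of_ne ?_)
  rintro rfl
  obtain ⟨x, hx⟩ := hR
  refine hx.2 (hZ.2 K hCZ hK.2.1.1 (fun a ha b hb hab => ?_) hx.1)
  by_contra hbK
  exact hKR ⟨a, ha, b, ⟨hb, hbK⟩, hab⟩

theorem Tour.pos {S A : Set V} {n : ℕ} {a b : V} (h : G.Tour S A n a b) (ha : a ∈ S) : 1 ≤ n := by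
  cases h with
  | single _ h1 => exact h1 ha
  | step _ _ _ _ h1 => exact Nat.one_le_of_lt (h1 ha)

/-- A tour that leaves `K`, necessarily through `S₁`, makes fewer visits to `S` before it does. -/
theorem Tour.exit {S S₁ A K : Set V} {n : ℕ} {a b : V} (ht : G.Tour S A n a b) (ha : a ∈ K)
    (hb : b ∉ K) (hS₁ : S₁ ⊆ S) (hK : ∀ a ∈ K, ∀ b ∈ A, G.Adj a b → b ∈ S₁ ∪ K) :
    ∃ n' < n, ∃ x ∈ K, ∃ s ∈ S₁, G.Adj x s ∧ G.Tour S K n' a x := by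
  classical
  induction ht with
  | single _ _ => exact absurd ha hb
  | @step n m a b c haA hab ht hmn h1 ih =>
    rcases hK a ha b ht.start_mem hab with hbS | hbK
    · have := ht.pos (hS₁ hbS)
      refine ⟨if a ∈ S then 1 else 0, ?_, a, ha, b, hbS, hab,
        Tour.single ha fun h => by simp [h]⟩
      split_ifs with h
      · have := h1 h; omega
      · omega
    · obtain ⟨n', hn', x, hx, s, hs, hxs, hT⟩ := ih hbK hb
      refine ⟨if a ∈ S then n' + 1 else n', ?_, x, hx, s, hs, hxs, Tour.step ha hab hT ?_ ?_⟩
      · split_ifs with h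
        · have := h1 h; omega
        · omega
      · split_ifs <;> omega
      · intro h; simp [h]

/-- Peeling repeatedly, each component that still contains a tower is treated with the root
extended by everything outside the component. If `u` reaches the neighbourhood of the root with `k`
visits to `S`, then at most `k + 1` of the peeled layers lie between `u` and the root. -/
theorem exists_layered_hitting_set [Finite V] [Finite W] [Nonempty W] {m h r N₁ N₂ : ℕ}
    (hm : 2 * Nat.card W + 1 < m) (hF : ∀ f ∈ F, G.ConnSet f) {Z : Set V} (hZ : G.ConnSet Z)
    (hno : ¬ G.HasTower F Y (h + 1) Z)
    (h₁ : ∀ F' C, (∀ f ∈ F', G.ConnSet f) → ¬ G.RichModel F' (Y.copies (Fin 2)) C →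
      G.HasHittingSet F' C r N₁)
    (h₂ : ∀ K, ¬ G.HasTower F (Y.copies (Fin m)) h K → G.HasHittingSet F K r N₂)
    (C : Set V) (hCZ : C ⊆ Z) (hR : G.ConnSet (Z \ C)) :
    ∃ (S : Set V) (ρ : V → ℕ), S ⊆ C ∧ (∀ f ∈ F, f ⊆ C → (f ∩ S).Nonempty) ∧
      ∀ u ∈ C, ∀ k ≤ r, (k = r ∨ ∃ x ∈ C, ∃ y ∈ Z \ C, G.Adj x y ∧ G.Tour S C k u x) →
        (G.WR C S ρ r u).ncard ≤ N₂ + N₁ * (k + 1) := by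
  induction hn : C.ncard using Nat.strong_induction_on generalizing C with
  | _ n ih =>
  subst hn
  obtain ⟨S', ρ', hS'C, hhit', hcard'⟩ := h₁ _ C (fun f hf => hf.1)
    (not_richModel_attachedTowers hm hCZ hR hno)
  obtain ⟨S₁, hS₁C, ⟨ρ₁, hρ₁⟩, hhit, hconn⟩ := exists_peeling hZ hCZ hR
    (F' := G.attachedTowers F (Y.copies (Fin m)) h Z C)
    (fun f hf => ⟨hf.1, hf.2.1, hf.2.2.2⟩)
    (fun S => ∃ ρ, ∀ u, (G.WR C S ρ r u).ncard ≤ N₁)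
    ⟨S', hS'C, ⟨ρ', hcard'⟩, fun f hf => hhit' f hf hf.2.1⟩
  obtain ⟨S, ρ, hSC, hS₁S, hW₁, hK⟩ := exists_extension (G := G) (ρ₁ := ρ₁) hS₁C
    (Q := fun K S ρ => (∀ f ∈ F, f ⊆ K → (f ∩ S).Nonempty) ∧
      ((∀ u, (G.WR K S ρ r u).ncard ≤ N₂) ∨
        ((¬ G.Touches K (Z \ C) ∧ ∀ a ∈ K, ∀ b ∈ Z, G.Adj a b → b ∈ S₁ ∪ K) ∧
          ∀ u ∈ K, ∀ k ≤ r, (k = r ∨ ∃ x ∈ K, ∃ y ∈ Z \ K, G.Adj x y ∧ G.Tour S K k u x) →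
            (G.WR K S ρ r u).ncard ≤ N₂ + N₁ * (k + 1)))) (by
    intro K hKc
    by_cases hT : G.HasTower F (Y.copies (Fin m)) h K
    · have hsep := hKc.not_touches_root hhit hT
      have hKconn : G.ConnSet (Z \ K) := by
        refine hconn K hKc.1 hsep.2 ?_
        intro D hD
        refine ⟨ρ₁, fun u => ?_⟩
        obtain ⟨u', hu'⟩ := WR_diff_subset (ρ := ρ₁) (r := r) (hKc.1.trans Set.sdiff_subset)
          hKc.2.1 (Set.disjoint_left.2 fun x hx => (hKc.1 hx).2) hD u
        exact (Set.ncard_le_ncard hu').trans (hρ₁ u')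
      obtain ⟨S, ρ, h1, h2, h3⟩ := ih _ (hKc.ncard_lt_of_not_touches hZ hCZ hR.1 hsep.1) K
        ((hKc.1.trans Set.sdiff_subset).trans hCZ) hKconn rfl
      exact ⟨S, ρ, h1, h2, Or.inr ⟨hsep, h3⟩⟩
    · obtain ⟨S, ρ, h1, h2, h3⟩ := h₂ K hT
      exact ⟨S, ρ, h1, h2, Or.inl h3⟩)
  refine ⟨S, ρ, hSC, fun f hf hfC => ?_, fun u hu k hkr hk => ?_⟩
  · by_cases hfS : (f ∩ S₁).Nonempty
    · exact hfS.mono (Set.inter_subset_inter_right _ hS₁S)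
    · have hsub : f ⊆ C \ S₁ := fun x hx => ⟨hfC hx, fun hxS => hfS ⟨x, hx, hxS⟩⟩
      obtain ⟨K, hKc, hfK⟩ := (hF f hf).exists_isComp_superset hsub
      obtain ⟨SK, ρK, ⟨hhitK, -⟩, hSK, -⟩ := hK K hKc
      refine (hhitK f hf hfK).mono (Set.inter_subset_inter_right _ ?_)
      rw [← hSK]; exact Set.inter_subset_left
  by_cases hu1 : u ∈ S₁
  · calc _ ≤ N₁ := (Set.ncard_le_ncard (hW₁ u hu1 r)).trans (hρ₁ u)
      _ ≤ N₂ + N₁ * (k + 1) := by nlinarith [Nat.zero_le (N₁ * k)]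
  obtain ⟨K, hKc, huK⟩ := exists_isComp (G := G) (A := C \ S₁) ⟨hu, hu1⟩
  obtain ⟨SK, ρK, ⟨-, hcase⟩, hSK, hsub⟩ := hK K hKc
  have hKC : K ⊆ C := hKc.1.trans Set.sdiff_subset
  have hun : (G.WR C S ρ r u).ncard ≤ N₁ + (G.WR K SK ρK r u).ncard :=
    (Set.ncard_le_ncard (hsub u huK r)).trans
      ((Set.ncard_union_le _ _).trans (Nat.add_le_add_right (hρ₁ u) _))
  rcases hcase with hcase | ⟨⟨hKR, hKn⟩, hcase⟩
  · have := hcase u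
    nlinarith [Nat.zero_le (N₁ * k)]
  have hSKS : SK ⊆ S := by rw [← hSK]; exact Set.inter_subset_left
  -- a tour that leaves `K` within `k` visits leaves one visit fewer for the layers inside `K`
  have hrec : ∀ n' < k, (∃ x ∈ K, ∃ s ∈ S₁, G.Adj x s ∧ G.Tour S K n' u x) →
      (G.WR C S ρ r u).ncard ≤ N₂ + N₁ * (k + 1) := by
    rintro n' hn' ⟨x, hx, s, hs, hxs, hT⟩
    have := hcase u huK (k - 1) (by omega) (Or.inr ⟨x, hx, s,
      ⟨hCZ (hS₁C hs), fun hsK => (hKc.1 hsK).2 hs⟩, hxs, hT.mono hSKS subset_rfl (by omega)⟩)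
    rw [show k - 1 + 1 = k by omega] at this
    nlinarith
  rcases hk with rfl | ⟨x, hx, y, hy, hxy, hT⟩
  · by_cases hS₁r : ∃ v ∈ S₁, v ∈ G.WR C S ρ k u
    · obtain ⟨v, hv, -, hvT⟩ := hS₁r
      obtain ⟨n', hn', hex⟩ := hvT.exit huK (fun h => (hKc.1 h).2 hv) hS₁S
        fun a ha b hb hab => hKn a ha b (hCZ hb.1) hab
      exact hrec n' hn' hex
    · refine (Set.ncard_le_ncard fun v hv => ?_).trans (hcase u huK k le_rfl (Or.inl rfl))
      exact (hsub u huK k hv).resolve_left fun hv1 => hS₁r ⟨v, hv1.1, hv⟩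
  · obtain ⟨n', hn', hex⟩ := hT.exit huK (fun h => hKR ⟨x, h, y, hy, hxy⟩) hS₁S
      fun a ha b hb hab => hKn a ha b (hCZ hb) hab
    exact hrec n' hn' hex

/-- A hitting set may be sought separately in the components that remain after the deletion of one
vertex from each component. -/
theorem hasHittingSet_of_roots [Finite V] (hF : ∀ f ∈ F, G.ConnSet f) {C₀ : Set V} {r N : ℕ}
    (h : ∀ Z, G.IsComp C₀ Z → ∀ x ∈ Z, ∀ C, G.IsComp (Z \ {x}) C → G.HasHittingSet F C r N) :
    G.HasHittingSet F C₀ r (1 + N) := by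
  have h0 : ∀ u, (G.WR C₀ ∅ (fun _ => 0) r u).ncard ≤ 0 := fun u => by
    have : G.WR C₀ ∅ (fun _ => 0) r u = ∅ := Set.eq_empty_of_forall_notMem fun v hv => hv.1
    simp [this]
  rw [← Nat.zero_add (1 + N)]
  refine hasHittingSet_of_comps hF (Set.empty_subset _) h0 fun Z hZ => ?_
  rw [Set.sdiff_empty] at hZ
  obtain ⟨x, hx⟩ := hZ.2.1.1
  refine hasHittingSet_of_comps hF (ρ₁ := fun _ => 0) (Set.singleton_subset_iff.2 hx) (fun u => ?_)
    (h Z hZ x hx)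
  rw [← Set.ncard_singleton x]
  exact Set.ncard_le_ncard fun v hv => hv.1

end Peel

/-! ### Bounds that are uniform over all graphs of bounded treewidth -/

/-- For families without a rich model of `Y`, hitting sets exist with reachability bounded by
`c * w * g r`, where `w` bounds the bags of a tree decomposition of the host graph. -/
def HitBound.{v} {W : Type*} (Y : SimpleGraph W) (g : ℕ → ℕ) : Prop :=
  ∃ c : ℕ, ∀ (V : Type v) [Finite V] (G : SimpleGraph V) (w : ℕ), 1 ≤ w →
    (∃ D : G.TreeDecomposition, ∀ x, (D.bag x).ncard ≤ w) →
    ∀ F : Set (Set V), (∀ f ∈ F, G.ConnSet f) → ∀ (C : Set V) (r : ℕ), 1 ≤ r →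
      ¬ G.RichModel F Y C → G.HasHittingSet F C r (c * w * g r)

/-- The analogue of `HitBound` for families without a rich tower of height `h` over `Y`. -/
def TowerBound.{v} {W : Type*} (Y : SimpleGraph W) (h : ℕ) (g : ℕ → ℕ) : Prop :=
  ∃ c : ℕ, ∀ (V : Type v) [Finite V] (G : SimpleGraph V) (w : ℕ), 1 ≤ w →
    (∃ D : G.TreeDecomposition, ∀ x, (D.bag x).ncard ≤ w) →
    ∀ F : Set (Set V), (∀ f ∈ F, G.ConnSet f) → ∀ (C : Set V) (r : ℕ), 1 ≤ r →
      ¬ G.HasTower F Y h C → G.HasHittingSet F C r (c * w * g r)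

section Bounds

universe v

theorem towerBound_zero {W : Type*} (Y : SimpleGraph W) (g : ℕ → ℕ) :
    TowerBound.{v} Y 0 g :=
  ⟨0, fun _ _ _ _ _ _ _ hF _ _ _ h => hasHittingSet_of_forall_not_subset fun f hf hfC =>
    h (hasTower_zero hf (hF f hf) hfC)⟩

theorem towerBound_of_isEmpty {W : Type*} [IsEmpty W] (Y : SimpleGraph W) (h : ℕ) (g : ℕ → ℕ) :
    TowerBound.{v} Y h g := by
  refine ⟨0, fun V _ G w _ _ F hF C r _ hno => hasHittingSet_of_forall_not_subset fun f hf hfC =>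
    hno ?_⟩
  have hb : G.ConnSet f ∧ f ⊆ f ∧ G.ConnSet f ∧ ∃ f' ∈ F, f' ⊆ f :=
    ⟨hF f hf, subset_rfl, hF f hf, f, hf, subset_rfl⟩
  refine ⟨f, f, hfC, ?_⟩
  cases h with
  | zero => exact hb
  | succ h => exact ⟨hb, isEmptyElim, isEmptyElim, isEmptyElim, isEmptyElim, isEmptyElim,
      isEmptyElim⟩

theorem copies_isContained {W A I J : Type*} {Y : SimpleGraph W} {H : SimpleGraph A} (φ : I ↪ J)
    (h : Y ⊑ H) : Y.copies I ⊑ H.copies J := by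
  obtain ⟨f⟩ := h
  refine ⟨⟨⟨fun p => (f p.1, φ p.2), fun h => ⟨f.toHom.map_adj h.1, congrArg φ h.2⟩⟩, ?_⟩⟩
  rintro ⟨a, i⟩ ⟨b, j⟩ hab
  obtain ⟨h1, h2⟩ := Prod.mk.injEq _ _ _ _ ▸ hab
  exact Prod.ext (f.injective h1) (φ.injective h2)

/-- Passing from a class of graphs to the towers over it costs a factor `r`. -/
theorem towerBound_of_hitBound {A : Type*} {H : SimpleGraph A} (hH : H.copies ℕ ⊑ H) {g : ℕ → ℕ}
    (hg : ∀ r, 1 ≤ r → 1 ≤ g r)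
    (hQ : ∀ (W : Type) [Finite W] (Y : SimpleGraph W), Y ⊑ H → HitBound.{v} Y g) (h : ℕ) :
    ∀ (W : Type) [Finite W] (Y : SimpleGraph W), Y ⊑ H →
      TowerBound.{v} Y h fun r => r * g r := by
  induction h with
  | zero => exact fun W _ Y _ => towerBound_zero Y _
  | succ h ih =>
    intro W _ Y hY
    cases isEmpty_or_nonempty W with
    | inl _ => exact towerBound_of_isEmpty Y _ _
    | inr _ =>
    have hcop : ∀ m, Y.copies (Fin m) ⊑ H := fun m =>
      (copies_isContained Fin.valEmbedding hY).trans hH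
    obtain ⟨c₁, hc₁⟩ := hQ _ _ (hcop 2)
    obtain ⟨c₂, hc₂⟩ := ih _ _ (hcop (2 * Nat.card W + 2))
    refine ⟨1 + c₂ + 2 * c₁, fun V _ G w hw hD F hF C₀ r hr hno => ?_⟩
    refine (hasHittingSet_of_roots hF (N := c₂ * w * (r * g r) + (c₁ * w * g r) * (r + 1))
      fun Z hZ x hx C hC => ?_).mono ?_
    · obtain ⟨S, ρ, h1, h2, h3⟩ := exists_layered_hitting_set (Y := Y) (r := r) (by omega) hF hZ.2.1
        (fun hT => hno (hT.subset hZ.1)) (fun F' C hF' => hc₁ V G w hw hD F' hF' C r hr)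
        (fun K => hc₂ V G w hw hD F hF K r hr) C (hC.1.trans Set.sdiff_subset)
        (hZ.2.1.diff_isComp_singleton hx hC)
      refine ⟨S, ρ, h1, h2, fun u => ?_⟩
      by_cases hu : u ∈ C
      · exact h3 u hu r le_rfl (Or.inl rfl)
      · have : G.WR C S ρ r u = ∅ :=
          Set.eq_empty_of_forall_notMem fun v hv => hu (mem_of_mem_WR hv)
        simp [this]
    · have h1 : 1 ≤ w * (r * g r) :=
        Nat.mul_pos hw (Nat.mul_pos hr (hg r hr))
      have h2 : c₁ * w * g r ≤ c₁ * w * (r * g r) :=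
        Nat.mul_le_mul_left _ (Nat.le_mul_of_pos_left _ hr)
      nlinarith

end Bounds

/-! ### Reachable layers in a linear order of layers -/

section Labels

/-- Order the positive integers by decreasing `2`-adic valuation. Positions within distance `r` such
that no position between two of them precedes both have distinct valuations, and all valuations
but the largest are at most `log₂ r`. -/
theorem card_le_log_of_padicValNat {r : ℕ} {J : Finset ℕ} (hpos : ∀ j ∈ J, 1 ≤ j)
    (h : ∀ j ∈ J, ∀ j' ∈ J, j < j' → j' - j ≤ r ∧ ∀ i, j ≤ i → i ≤ j' →
      padicValNat 2 i ≤ max (padicValNat 2 j) (padicValNat 2 j')) :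
    J.card ≤ Nat.log 2 r + 2 := by
  have hdvd : ∀ j, 2 ^ padicValNat 2 j ∣ j := fun j => pow_padicValNat_dvd
  have hne : ∀ j ∈ J, ∀ j' ∈ J, j < j' → padicValNat 2 j ≠ padicValNat 2 j' := by
    intro j hj j' hj' hlt heq
    obtain ⟨a, ha⟩ := hdvd j
    obtain ⟨b, hb⟩ := hdvd j'
    rw [← heq] at hb
    set k := padicValNat 2 j with hk
    have hodd : ∀ i c, i ∈ J → padicValNat 2 i = k → i = 2 ^ k * c → c % 2 = 1 := by
      intro i c hi hik hc
      by_contra hmod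
      obtain ⟨c', rfl⟩ : 2 ∣ c := by omega
      have : 2 ^ (k + 1) ∣ i := ⟨c', by rw [hc]; ring⟩
      have := (padicValNat_dvd_iff_le (p := 2) (by have := hpos i hi; omega)).1 this
      omega
    have ha2 := hodd j a hj rfl ha
    have hb2 := hodd j' b hj' heq.symm hb
    have hab : a < b := by
      rw [ha, hb] at hlt
      exact Nat.lt_of_mul_lt_mul_left hlt
    -- between two odd multiples of `2 ^ k` lies an even one
    have hmid := (h j hj j' hj' hlt).2 (2 ^ k * (a + 1))
      (by rw [ha]; exact Nat.mul_le_mul_left _ (by omega))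
      (by rw [hb]; exact Nat.mul_le_mul_left _ hab)
    have hd : 2 ^ (k + 1) ∣ 2 ^ k * (a + 1) := by
      obtain ⟨c, hc⟩ : 2 ∣ a + 1 := by omega
      exact ⟨c, by rw [hc]; ring⟩
    have := (padicValNat_dvd_iff_le (p := 2) (by positivity)).1 hd
    rw [← heq, max_self] at hmid
    omega
  have hinj : Set.InjOn (padicValNat 2) (J : Set ℕ) := by
    intro j hj j' hj' heq
    rcases lt_trichotomy j j' with hlt | rfl | hlt
    · exact absurd heq (hne j hj j' hj' hlt)
    · rfl
    · exact absurd heq.symm (hne j' hj' j hj hlt)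
  rcases J.eq_empty_or_nonempty with rfl | hJ
  · simp
  obtain ⟨j₀, hj₀, hmax⟩ := J.exists_max_image (padicValNat 2) hJ
  have hsub : J.image (padicValNat 2) ⊆
      insert (padicValNat 2 j₀) (Finset.range (Nat.log 2 r + 1)) := by
    intro k hk
    obtain ⟨j, hj, rfl⟩ := Finset.mem_image.1 hk
    rw [Finset.mem_insert, Finset.mem_range, Nat.lt_succ_iff]
    by_cases heq : padicValNat 2 j = padicValNat 2 j₀
    · exact Or.inl heq
    right
    have h1 : 2 ^ padicValNat 2 j ∣ j₀ := (pow_dvd_pow 2 (hmax j hj)).trans (hdvd j₀)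
    have hle : ∀ x y, x ∈ J → y ∈ J → x < y → 2 ^ padicValNat 2 j ∣ x →
        2 ^ padicValNat 2 j ∣ y → padicValNat 2 j ≤ Nat.log 2 r := by
      intro x y hx hy hxy hdx hdy
      have := Nat.le_of_dvd (by omega) (Nat.dvd_sub hdy hdx)
      exact Nat.le_log_of_pow_le (by norm_num) (this.trans (h x hx y hy hxy).1)
    rcases lt_trichotomy j j₀ with hlt | rfl | hlt
    · exact hle j j₀ hj hj₀ hlt (hdvd j) h1
    · exact absurd rfl heq
    · exact hle j₀ j hj₀ hj hlt h1 (hdvd j)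
  calc J.card = (J.image (padicValNat 2)).card := (Finset.card_image_of_injOn hinj).symm
    _ ≤ _ := Finset.card_le_card hsub
    _ ≤ _ := Finset.card_insert_le _ _
    _ = Nat.log 2 r + 2 := by rw [Finset.card_range]

variable {V : Type*} {G : SimpleGraph V}

/-- The even values of `l` mark layers, and no edge inside `C` jumps over a layer. -/
def LayersSeparate (G : SimpleGraph V) (C : Set V) (l : V → ℕ) : Prop :=
  ∀ a ∈ C, ∀ b ∈ C, G.Adj a b → ∀ j, l a < 2 * j → ¬ 2 * j < l b

theorem LayersSeparate.tour_meets {C S A : Set V} {l : V → ℕ} (hl : G.LayersSeparate C l)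
    (hAC : A ⊆ C) {n : ℕ} {a b : V} (ht : G.Tour S A n a b) (j : ℕ)
    (hj : (l a ≤ 2 * j ∧ 2 * j ≤ l b) ∨ (l b ≤ 2 * j ∧ 2 * j ≤ l a)) : ∃ w ∈ A, l w = 2 * j := by
  induction ht with
  | @single n a ha h1 => exact ⟨a, ha, by omega⟩
  | @step n m a b c ha hab ht hmn h1 ih =>
    by_cases heq : l a = 2 * j
    · exact ⟨a, ha, heq⟩
    have h2 := hl a (hAC ha) b (hAC ht.start_mem) hab j
    have h3 := hl b (hAC ht.start_mem) a (hAC ha) hab.symm j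
    exact ih (by omega)

theorem LayersSeparate.tour_le {C A : Set V} {l : V → ℕ} (hl : G.LayersSeparate C l)
    (hAC : A ⊆ C) {n : ℕ} {a b : V} (ht : G.Tour {v | v ∈ C ∧ Even (l v)} A n a b) :
    (l b + 1) / 2 ≤ (l a + 1) / 2 + n ∧ l a / 2 ≤ l b / 2 + n := by
  induction ht with
  | single ha h1 => omega
  | @step n m a b c ha hab ht hmn h1 ih =>
    have hbC := hAC ht.start_mem
    have h2 := hl a (hAC ha) b hbC hab ((l a + 1) / 2)
    have h2' := hl a (hAC ha) b hbC hab ((l a + 1) / 2 + 1)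
    have h3 := hl b hbC a (hAC ha) hab.symm (l a / 2)
    have h3' := hl b hbC a (hAC ha) hab.symm (l a / 2 - 1)
    rcases Nat.even_or_odd (l a) with he | ho
    · have := h1 ⟨hAC ha, he⟩
      obtain ⟨i, hi⟩ := he
      omega
    · obtain ⟨i, hi⟩ := ho
      omega

theorem ncard_le_of_layers [Finite V] {T : Set V} {l : V → ℕ} {r N : ℕ}
    (hpos : ∀ v ∈ T, 1 ≤ l v) (heven : ∀ v ∈ T, Even (l v))
    (hN : ∀ j, {v | v ∈ T ∧ l v = 2 * j}.ncard ≤ N)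
    (h : ∀ v ∈ T, ∀ v' ∈ T, l v < l v' → l v' ≤ l v + 2 * r ∧ ∀ i, l v ≤ 2 * i → 2 * i ≤ l v' →
      padicValNat 2 i ≤ max (padicValNat 2 (l v / 2)) (padicValNat 2 (l v' / 2))) :
    T.ncard ≤ N * (Nat.log 2 r + 2) := by
  classical
  have := Fintype.ofFinite V
  rw [Set.ncard_eq_toFinset_card' T]
  refine (Finset.card_le_mul_card_image (f := fun v => l v / 2) T.toFinset N ?_).trans
    (Nat.mul_le_mul_left _ (card_le_log_of_padicValNat (r := r) ?_ ?_))
  · intro j _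
    refine le_trans (le_of_eq ?_) (hN j)
    rw [Set.ncard_eq_toFinset_card']
    congr 1
    ext v
    simp only [Finset.mem_filter, Set.mem_toFinset, Set.mem_ofPred_eq]
    refine and_congr_right fun hv => ?_
    obtain ⟨i, hi⟩ := heven v hv
    omega
  · intro j hj
    obtain ⟨v, hv, rfl⟩ := Finset.mem_image.1 hj
    rw [Set.mem_toFinset] at hv
    have := hpos v hv
    obtain ⟨i, hi⟩ := heven v hv
    omega
  · intro j hj j' hj' hlt
    obtain ⟨v, hv, rfl⟩ := Finset.mem_image.1 hj
    obtain ⟨v', hv', rfl⟩ := Finset.mem_image.1 hj'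
    rw [Set.mem_toFinset] at hv hv'
    obtain ⟨i, hi⟩ := heven v hv
    obtain ⟨i', hi'⟩ := heven v' hv'
    obtain ⟨h1, h2⟩ := h v hv v' hv' (by omega)
    exact ⟨by omega, fun i h3 h4 => h2 i (by omega) (by omega)⟩

/-- Layers of size at most `N` that separate the graph linearly, ordered by decreasing `2`-adic
valuation of their position, have at most logarithmically many reachable layers on each side. -/
theorem LayersSeparate.exists_order [Finite V] {C : Set V} {l : V → ℕ}
    (hl : G.LayersSeparate C l) (hpos : ∀ v ∈ C, 1 ≤ l v) {N r : ℕ}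
    (hN : ∀ j, {v | v ∈ C ∧ l v = 2 * j}.ncard ≤ N) :
    ∃ ρ : V → ℕ, ∀ u, (G.WR C {v | v ∈ C ∧ Even (l v)} ρ r u).ncard ≤
      N * (2 * (Nat.log 2 r + 2)) := by
  obtain ⟨M, hM⟩ : ∃ M, ∀ v, padicValNat 2 (l v / 2) ≤ M := by
    obtain ⟨M, hM⟩ := (Set.finite_range fun v => padicValNat 2 (l v / 2)).bddAbove
    exact ⟨M, fun v => hM ⟨v, rfl⟩⟩
  -- as `M` bounds the valuations, the subtraction reverses their order
  refine ⟨fun v => M - padicValNat 2 (l v / 2), fun u => ?_⟩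
  set S : Set V := {v | v ∈ C ∧ Even (l v)} with hS
  set R := G.WR C S (fun v => M - padicValNat 2 (l v / 2)) r u with hR
  have hRC : ∀ v ∈ R, v ∈ C ∧ Even (l v) := fun v hv => hv.1
  have htour : ∀ v ∈ R, ((l v + 1) / 2 ≤ (l u + 1) / 2 + r ∧ l u / 2 ≤ l v / 2 + r) ∧
      ∀ i, (l u ≤ 2 * i ∧ 2 * i ≤ l v) ∨ (l v ≤ 2 * i ∧ 2 * i ≤ l u) →
        padicValNat 2 i ≤ padicValNat 2 (l v / 2) := by
    intro v hv
    refine ⟨hl.tour_le (fun w hw => hw.1) hv.2, fun i hi => ?_⟩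
    obtain ⟨w, ⟨hwC, hw⟩, hwi⟩ := hl.tour_meets (fun w hw => hw.1) hv.2 i hi
    have h1 : M - padicValNat 2 (l v / 2) ≤ M - padicValNat 2 (l w / 2) :=
      hw ⟨hwC, by rw [hwi]; exact even_two_mul i⟩
    have h2 := hM v
    have h3 := hM w
    rw [hwi, Nat.mul_div_cancel_left i (by norm_num)] at h1 h3
    omega
  have hsub : R ⊆ {v | v ∈ R ∧ l u ≤ l v} ∪ {v | v ∈ R ∧ l v ≤ l u} := by
    intro v hv
    rcases le_total (l u) (l v) with h | h
    · exact Or.inl ⟨hv, h⟩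
    · exact Or.inr ⟨hv, h⟩
  have hN' : ∀ (p : V → Prop) (j : ℕ), {v | v ∈ {v | v ∈ R ∧ p v} ∧ l v = 2 * j}.ncard ≤ N :=
    fun p j => by
      refine (Set.ncard_le_ncard ?_).trans (hN j)
      rintro v ⟨⟨hv, -⟩, hvj⟩
      exact ⟨(hRC v hv).1, hvj⟩
  have hup : {v | v ∈ R ∧ l u ≤ l v}.ncard ≤ N * (Nat.log 2 r + 2) := by
    refine ncard_le_of_layers (l := l) (fun v hv => hpos v (hRC v hv.1).1)
      (fun v hv => (hRC v hv.1).2) (hN' _) ?_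
    rintro v ⟨hv, huv⟩ v' ⟨hv', huv'⟩ hlt
    obtain ⟨h1, h2⟩ := htour v' hv'
    obtain ⟨i, hi⟩ := (hRC v hv).2
    obtain ⟨i', hi'⟩ := (hRC v' hv').2
    exact ⟨by omega, fun j hj hj' => le_max_of_le_right (h2 j (by omega))⟩
  have hdown : {v | v ∈ R ∧ l v ≤ l u}.ncard ≤ N * (Nat.log 2 r + 2) := by
    refine ncard_le_of_layers (l := l) (fun v hv => hpos v (hRC v hv.1).1)
      (fun v hv => (hRC v hv.1).2) (hN' _) ?_
    rintro v ⟨hv, huv⟩ v' ⟨hv', huv'⟩ hlt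
    obtain ⟨h1, h2⟩ := htour v hv
    obtain ⟨i, hi⟩ := (hRC v hv).2
    obtain ⟨i', hi'⟩ := (hRC v' hv').2
    exact ⟨by omega, fun j hj hj' => le_max_of_le_left (h2 j (by omega))⟩
  calc R.ncard ≤ _ := Set.ncard_le_ncard hsub
    _ ≤ _ := Set.ncard_union_le _ _
    _ ≤ N * (Nat.log 2 r + 2) + N * (Nat.log 2 r + 2) := Nat.add_le_add hup hdown
    _ = _ := by ring

end Labels

/-! ### Towers over edgeless graphs -/

/-- Disjoint connected subsets of `C`, each containing a tower, whose removal leaves a connected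
set that all of them touch. -/
def TowerFamily {V W : Type*} (G : SimpleGraph V) (F : Set (Set V)) (Y : SimpleGraph W) (h : ℕ)
    (Z C : Set V) (𝒟 : Set (Set V)) : Prop :=
  (∀ D ∈ 𝒟, D ⊆ C ∧ G.ConnSet D ∧ G.HasTower F Y h D ∧ G.Touches D (Z \ ⋃₀ 𝒟)) ∧
    𝒟.PairwiseDisjoint id ∧ G.ConnSet (Z \ ⋃₀ 𝒟)

section LogStep

variable {V W : Type*} {G : SimpleGraph V} {F : Set (Set V)} {Y : SimpleGraph W}

/-- Over an edgeless graph `Y`, a sufficiently large family of towers forms a higher tower. -/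
theorem TowerFamily.hasTower_succ [Finite V] [Finite W] (hY : Y = ⊥) {m h : ℕ}
    (hm : 2 * Nat.card W + 1 < m) {Z C : Set V} (hCZ : C ⊆ Z) {𝒟 : Set (Set V)}
    (h𝒟 : G.TowerFamily F (Y.copies (Fin m)) h Z C 𝒟) (hcard : 𝒟.ncard = Nat.card W + 1) :
    G.HasTower F Y (h + 1) Z := by
  obtain ⟨h1, h2, h3⟩ := h𝒟
  obtain ⟨e⟩ : Nonempty (Option W ≃ 𝒟) :=
    (Finite.card_eq).1 (by rw [Finite.card_option, Nat.card_coe_set_eq, hcard])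
  have hmem : ∀ o, (e o : Set V) ∈ 𝒟 := fun o => (e o).2
  have hdisj : ∀ o o', o ≠ o' → Disjoint (e o : Set V) (e o') := fun o o' ho =>
    h2 (hmem o) (hmem o') fun h => ho (e.injective (Subtype.ext h))
  have hE := h1 _ (hmem none)
  refine SimpleGraph.hasTower_succ hm (h3.union hE.2.1 (Or.inr hE.2.2.2.symm))
    (B := fun y => e (some y)) (Set.union_subset Set.sdiff_subset (hE.1.trans hCZ)) ?_
    (fun y => ⟨(h1 _ (hmem _)).2.1, (h1 _ (hmem _)).1.trans hCZ, (h1 _ (hmem _)).2.2.1⟩)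
    (fun y => ⟨(h1 _ (hmem _)).2.2.2.symm.mono Set.subset_union_left subset_rfl, ?_⟩)
    (fun y y' hyy => hdisj _ _ (by simpa using hyy)) ?_
  · obtain ⟨f, hf, hfE⟩ := hE.2.2.1.exists_mem
    exact ⟨f, hf, hfE.trans Set.subset_union_right⟩
  · rw [Set.disjoint_union_right]
    exact ⟨Set.disjoint_left.2 fun x hx hx' => hx'.2 ⟨_, hmem _, hx⟩, hdisj _ _ (by simp)⟩
  · subst hY
    exact fun y y' hyy => absurd hyy (by simp)

/-- A family inside one component `K` can be extended by a second component `K'`, provided that the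
deletion of both components keeps `Z` connected. -/
theorem TowerFamily.insert {Z C S K K' : Set V} {h : ℕ} {𝒟 : Set (Set V)} (hZ : G.ConnSet Z)
    (hCZ : C ⊆ Z) (hR : G.ConnSet (Z \ C))
    (h𝒟 : G.TowerFamily F Y h Z K 𝒟) (hK : G.IsComp (C \ S) K) (hK' : G.IsComp (C \ S) K')
    (hne : K ≠ K') (hT : G.HasTower F Y h K')
    (hKn : ∀ a ∈ K, ∀ b ∈ Z, G.Adj a b → b ∈ S ∪ K)
    (hKn' : ∀ a ∈ K', ∀ b ∈ Z, G.Adj a b → b ∈ S ∪ K')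
    (hconn : G.ConnSet (Z \ (K ∪ K'))) : G.TowerFamily F Y h Z C (insert K' 𝒟) := by
  obtain ⟨h1, h2, h3⟩ := h𝒟
  have hdisj : Disjoint K K' := hK.disjoint_of_ne hK' hne
  have hKC : K ⊆ C := hK.1.trans Set.sdiff_subset
  have hKC' : K' ⊆ C := hK'.1.trans Set.sdiff_subset
  have hUK : ⋃₀ 𝒟 ⊆ K := Set.sUnion_subset fun D hD => (h1 D hD).1
  have hnot : ∀ a ∈ K, ∀ b ∈ K', ¬ G.Adj a b := fun a ha b hb hab =>
    (hKn a ha b (hCZ (hKC' hb)) hab).elim (fun h => (hK'.1 hb).2 h)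
      fun h => Set.disjoint_left.1 hdisj h hb
  have hZU : Z \ ⋃₀ (Insert.insert K' 𝒟) = Z \ (K' ∪ ⋃₀ 𝒟) := by rw [Set.sUnion_insert]
  obtain ⟨z, hz⟩ := hR.1
  refine ⟨?_, ?_, ?_⟩
  · rw [hZU]
    rintro D (rfl | hD)
    · refine ⟨hKC', hK'.2.1, hT, ?_⟩
      by_contra hcon
      refine hz.2 (hKC' (hZ.2 D (hKC'.trans hCZ) hK'.2.1.1 (fun a ha b hb hab => ?_) hz.1))
      refine (hKn' a ha b hb hab).resolve_left fun hbS => hcon ⟨a, ha, b, ⟨hb, ?_⟩, hab⟩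
      rintro (h | h)
      · exact (hK'.1 h).2 hbS
      · exact (hK.1 (hUK h)).2 hbS
    · obtain ⟨hDK, hDc, hDT, a, ha, b, hb, hab⟩ := h1 D hD
      refine ⟨hDK.trans hKC, hDc, hDT, a, ha, b, ⟨hb.1, ?_⟩, hab⟩
      rintro (h | h)
      · exact hnot a (hDK ha) b h hab
      · exact hb.2 h
  · refine h2.insert fun D hD _ => ?_
    exact (hdisj.mono_left (h1 D hD).1).symm
  · rw [hZU]
    have hzU : z ∈ Z \ (K ∪ K') := ⟨hz.1, fun h => hz.2 (h.elim (fun h => hKC h) fun h => hKC' h)⟩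
    refine hR.of_closedIn_empty (fun x hx => ⟨hx.1, fun h => hx.2 (h.elim (fun h => hKC' h)
      fun h => hKC (hUK h))⟩) ?_
    intro D hD hDR hDcl
    have hzD : z ∉ D := fun h => Set.disjoint_left.1 hDR h hz
    have hDK : D ⊆ K := by
      intro x hx
      by_contra hxK
      refine hzD (hconn.2 (D ∩ (Z \ (K ∪ K'))) Set.inter_subset_right ⟨x, hx, (hD hx).1, ?_⟩ ?_
        hzU).1
      · exact fun h => h.elim hxK fun h => (hD hx).2 (Or.inl h)
      · rintro a ⟨ha, -⟩ b hb hab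
        exact ⟨hDcl a ha b ⟨hb.1, fun h => hb.2 (h.elim Or.inr fun h => Or.inl (hUK h))⟩ hab, hb⟩
    by_contra hDne
    refine hzD (h3.2 D (fun x hx => ⟨(hD hx).1, fun h => (hD hx).2 (Or.inr h)⟩)
      (Set.nonempty_iff_ne_empty.2 hDne) ?_ ⟨hz.1, fun h => hz.2 (hKC (hUK h))⟩)
    intro a ha b hb hab
    exact hDcl a ha b ⟨hb.1, fun h => h.elim (fun h => hnot a (hDK ha) b h hab) hb.2⟩ hab

/-- Peeling as long as some component still contains a family of `μ` towers produces a linear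
sequence of small layers: any other component with a tower would give a family of `μ + 1`. -/
theorem exists_chain_labelling [Finite V] [Finite W] [Nonempty W] {m h r N₁ N₂ μ : ℕ}
    (hm : 2 * Nat.card W + 1 < m) {Z : Set V} (hZ : G.ConnSet Z)
    (hno : ¬ G.HasTower F Y (h + 1) Z)
    (h₁ : ∀ F' C, (∀ f ∈ F', G.ConnSet f) → ¬ G.RichModel F' (Y.copies (Fin 2)) C →
      ∃ S ⊆ C, S.ncard ≤ N₁ ∧ ∀ f ∈ F', f ⊆ C → (f ∩ S).Nonempty)
    (h₂ : ∀ K, ¬ G.HasTower F (Y.copies (Fin m)) h K → G.HasHittingSet F K r N₂)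
    (hμ : ∀ C ⊆ Z, G.ConnSet (Z \ C) →
      (∀ 𝒟, G.TowerFamily F (Y.copies (Fin m)) h Z C 𝒟 → 𝒟.ncard ≠ μ) →
      G.HasHittingSet F C r N₂)
    (C : Set V) (hCZ : C ⊆ Z) (hR : G.ConnSet (Z \ C))
    (hC : ∀ 𝒟, G.TowerFamily F (Y.copies (Fin m)) h Z C 𝒟 → 𝒟.ncard ≠ μ + 1) :
    ∃ l : V → ℕ, (∀ v ∈ C, 1 ≤ l v) ∧ (∀ j, {v | v ∈ C ∧ l v = 2 * j}.ncard ≤ N₁) ∧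
      (∀ K, G.IsComp {v | v ∈ C ∧ ¬ Even (l v)} K → G.HasHittingSet F K r N₂) ∧
      G.LayersSeparate C l ∧ ∀ v ∈ C, 2 < l v → ∀ y ∈ Z \ C, ¬ G.Adj v y := by
  classical
  induction hn : C.ncard using Nat.strong_induction_on generalizing C with
  | _ n ih =>
  subst hn
  obtain ⟨S₁, hS₁C, hS₁N, hhit, hconn⟩ := exists_peeling hZ hCZ hR
    (F' := G.attachedTowers F (Y.copies (Fin m)) h Z C)
    (fun f hf => ⟨hf.1, hf.2.1, hf.2.2.2⟩) (fun S => S.ncard ≤ N₁) (by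
      obtain ⟨S, hSC, hSN, hhit⟩ := h₁ _ C (fun f hf => hf.1)
        (not_richModel_attachedTowers hm hCZ hR hno)
      exact ⟨S, hSC, hSN, fun f hf => hhit f hf hf.2.1⟩)
  have hconn' : ∀ U ⊆ C \ S₁, (∀ a ∈ U, ∀ b ∈ Z, G.Adj a b → b ∈ S₁ ∪ U) → G.ConnSet (Z \ U) :=
    fun U hU hUn => hconn U hU hUn fun D _ =>
      (Set.ncard_le_ncard Set.sdiff_subset).trans hS₁N
  by_cases hcase : ∃ K, G.IsComp (C \ S₁) K ∧ G.HasTower F (Y.copies (Fin m)) h K ∧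
      ∃ 𝒟, G.TowerFamily F (Y.copies (Fin m)) h Z K 𝒟 ∧ 𝒟.ncard = μ
  · obtain ⟨K, hK, hKT, 𝒟, h𝒟, h𝒟μ⟩ := hcase
    have hKC : K ⊆ C := hK.1.trans Set.sdiff_subset
    have hKS : ∀ v ∈ K, v ∉ S₁ := fun v hv => (hK.1 hv).2
    obtain ⟨hKR, hKn⟩ := hK.not_touches_root hhit hKT
    obtain ⟨l, hl1, hl2, hl3, hl4, hl5⟩ := ih _ (hK.ncard_lt_of_not_touches hZ hCZ hR.1 hKR) K
      (hKC.trans hCZ) (hconn' K hK.1 hKn)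
      (fun 𝒟 h𝒟 => hC 𝒟 ⟨fun D hD => ⟨(h𝒟.1 D hD).1.trans hKC, (h𝒟.1 D hD).2⟩, h𝒟.2⟩) rfl
    -- `S₁` becomes the first layer, the labels of `K` are shifted by one layer, and the other
    -- components may touch both `S₁` and the root, so they come before `S₁`
    set l' : V → ℕ := fun v => if v ∈ K then l v + 2 else if v ∈ S₁ then 2 else 1 with hl'
    have hlK : ∀ v ∈ K, l' v = l v + 2 := fun v hv => by simp [hl', hv]
    have hlS : ∀ v ∈ S₁, l' v = 2 := fun v hv => by
      have : v ∉ K := fun h => hKS v h hv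
      simp [hl', hv, this]
    have hlo : ∀ v, v ∉ K → v ∉ S₁ → l' v = 1 := fun v h1 h2 => by simp [hl', h1, h2]
    have hle : ∀ v, v ∉ K → l' v ≤ 2 := fun v h1 => by
      by_cases h2 : v ∈ S₁
      · rw [hlS v h2]
      · rw [hlo v h1 h2]; norm_num
    refine ⟨l', fun v _ => ?_, fun j => ?_, fun K' hK' => ?_, fun a ha b hb hab j => ?_,
      fun v hv hlv y hy hvy => ?_⟩
    · simp only [hl']
      split_ifs <;> omega
    · by_cases hj : j = 1
      · refine (Set.ncard_le_ncard ?_).trans hS₁N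
        rintro v ⟨hv, hvj⟩
        by_contra hvS
        by_cases hvK : v ∈ K
        · have := hl1 v hvK
          rw [hlK v hvK] at hvj
          omega
        · rw [hlo v hvK hvS] at hvj
          omega
      · refine (Set.ncard_le_ncard ?_).trans (hl2 (j - 1))
        rintro v ⟨hv, hvj⟩
        by_cases hvK : v ∈ K
        · rw [hlK v hvK] at hvj
          exact ⟨hvK, by omega⟩
        · by_cases hvS : v ∈ S₁
          · rw [hlS v hvS] at hvj
            omega
          · rw [hlo v hvK hvS] at hvj
            omega
    · have hoddS : {v | v ∈ C ∧ ¬ Even (l' v)} ⊆ C \ S₁ := by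
        rintro v ⟨hv, hvo⟩
        refine ⟨hv, fun hvS => hvo ?_⟩
        rw [hlS v hvS]
        exact even_two
      have hoddK : {v | v ∈ K ∧ ¬ Even (l v)} ⊆ {v | v ∈ C ∧ ¬ Even (l' v)} := by
        rintro v ⟨hv, hvo⟩
        refine ⟨hKC hv, fun he => hvo ?_⟩
        rw [hlK v hv] at he
        exact (Nat.even_add.1 he).2 even_two
      obtain ⟨x, hx⟩ := hK'.2.1.1
      by_cases hxK : x ∈ K
      · have hsub : K' ⊆ K :=
          hK'.2.1.subset_of_closedIn (hK'.1.trans hoddS) hK.2.2 ⟨x, hx, hxK⟩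
        refine hl3 K' ⟨fun v hv => ⟨hsub hv, fun he => (hK'.1 hv).2 ?_⟩, hK'.2.1,
          hK'.2.2.mono hoddK⟩
        rw [hlK v (hsub hv)]
        exact he.add even_two
      · obtain ⟨K'', hK'', hxK''⟩ := exists_isComp (G := G) (hoddS (hK'.1 hx))
        have hne : K ≠ K'' := fun h => hxK (h ▸ hxK'')
        have hd := hK.disjoint_of_ne hK'' hne
        have hcomp : G.IsComp {v | v ∈ C ∧ ¬ Even (l' v)} K'' := by
          refine ⟨fun v hv => ⟨(hK''.1 hv).1, ?_⟩, hK''.2.1, hK''.2.2.mono hoddS⟩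
          rw [hlo v (Set.disjoint_right.1 hd hv) (hK''.1 hv).2]
          exact Nat.not_even_one
        rw [hK'.eq_of_mem hcomp hx hxK'']
        refine h₂ _ fun hT => ?_
        have hsep := hK''.not_touches_root hhit hT
        refine hC _ (h𝒟.insert hZ hCZ hR hK hK'' hne hT hKn hsep.2
          (hconn' _ (Set.union_subset hK.1 hK''.1) ?_)) ?_
        · rintro a (ha | ha) b hb hab
          · exact (hKn a ha b hb hab).imp id Or.inl
          · exact (hsep.2 a ha b hb hab).imp id Or.inr
        · rw [Set.ncard_insert_of_notMem (fun hmem => hxK ((h𝒟.1 _ hmem).1 hxK''))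
            (Set.toFinite _), h𝒟μ]
    · by_cases haK : a ∈ K
      · by_cases hbK : b ∈ K
        · have := hl4 a haK b hbK hab (j - 1)
          rw [hlK a haK, hlK b hbK]
          omega
        · have := hl1 a haK
          have := hle b hbK
          rw [hlK a haK]
          omega
      · by_cases hbK : b ∈ K
        · have haS : a ∈ S₁ := (hKn b hbK a (hCZ ha) hab.symm).resolve_right haK
          rw [hlS a haS, hlK b hbK]
          intro h1 h2
          exact hl5 b hbK (by omega) a ⟨hCZ ha, haK⟩ hab.symm
        · have := hle b hbK
          omega
    · by_cases hvK : v ∈ K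
      · exact hKR ⟨v, hvK, y, hy, hvy⟩
      · have := hle v hvK
        omega
  · refine ⟨fun v => if v ∈ S₁ then 2 else 1, fun v _ => ?_, fun j => ?_, fun K hK => ?_,
      fun a ha b hb hab j => ?_, fun v hv hlv => ?_⟩
    · dsimp only
      split_ifs <;> norm_num
    · refine (Set.ncard_le_ncard ?_).trans hS₁N
      rintro v ⟨hv, hvj⟩
      by_contra hvS
      dsimp only at hvj
      rw [if_neg hvS] at hvj
      omega
    · have heq : {v | v ∈ C ∧ ¬ Even (if v ∈ S₁ then 2 else 1)} = C \ S₁ := by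
        ext v
        by_cases hv : v ∈ S₁ <;> simp [hv]
      rw [heq] at hK
      by_cases hT : G.HasTower F (Y.copies (Fin m)) h K
      · have hsep := hK.not_touches_root hhit hT
        exact hμ K ((hK.1.trans Set.sdiff_subset).trans hCZ) (hconn' K hK.1 hsep.2)
          fun 𝒟 h𝒟 h𝒟μ => hcase ⟨K, hK, hT, 𝒟, h𝒟, h𝒟μ⟩
      · exact h₂ K hT
    · dsimp only
      split_ifs <;> omega
    · dsimp only at hlv
      split_ifs at hlv <;> omega

/-- Induction on the size `μ` of the excluded families: each of the at most `μ` linear sequences of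
layers that lie above a vertex contributes logarithmically many reachable layers. -/
theorem hasHittingSet_of_forall_towerFamily [Finite V] [Finite W] [Nonempty W]
    {m h r N₁ N₂ : ℕ} (hm : 2 * Nat.card W + 1 < m) (hF : ∀ f ∈ F, G.ConnSet f) {Z : Set V}
    (hZ : G.ConnSet Z) (hno : ¬ G.HasTower F Y (h + 1) Z)
    (h₁ : ∀ F' C, (∀ f ∈ F', G.ConnSet f) → ¬ G.RichModel F' (Y.copies (Fin 2)) C →
      ∃ S ⊆ C, S.ncard ≤ N₁ ∧ ∀ f ∈ F', f ⊆ C → (f ∩ S).Nonempty)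
    (h₂ : ∀ K, ¬ G.HasTower F (Y.copies (Fin m)) h K → G.HasHittingSet F K r N₂)
    (μ : ℕ) (C : Set V) (hCZ : C ⊆ Z) (hR : G.ConnSet (Z \ C))
    (hC : ∀ 𝒟, G.TowerFamily F (Y.copies (Fin m)) h Z C 𝒟 → 𝒟.ncard ≠ μ) :
    G.HasHittingSet F C r (μ * (N₁ * (2 * (Nat.log 2 r + 2))) + N₂) := by
  induction μ generalizing C with
  | zero =>
    exact absurd (Set.ncard_empty _)
      (hC ∅ ⟨by simp, Set.pairwiseDisjoint_empty, by simpa using hZ⟩)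
  | succ μ ih =>
    obtain ⟨l, hl1, hl2, hl3, hl4, -⟩ := exists_chain_labelling hm hZ hno h₁
      (fun K hK => (h₂ K hK).mono (Nat.le_add_left _ (μ * (N₁ * (2 * (Nat.log 2 r + 2)))))) ih
      C hCZ hR hC
    obtain ⟨ρ, hρ⟩ := hl4.exists_order (r := r) hl1 hl2
    refine (hasHittingSet_of_comps hF (S₁ := {v | v ∈ C ∧ Even (l v)}) (fun v hv => hv.1) hρ
      fun K hK => hl3 K ?_).mono (le_of_eq (by ring))
    rwa [show {v | v ∈ C ∧ ¬ Even (l v)} = C \ {v | v ∈ C ∧ Even (l v)} by ext v; simp]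

universe v

/-- The towers over edgeless graphs cost only a logarithmic factor. -/
theorem towerBound_log (h : ℕ) :
    ∀ (W : Type) [Finite W] (Y : SimpleGraph W), Y = ⊥ →
      TowerBound.{v} Y h fun r => Nat.log 2 r + 1 := by
  induction h with
  | zero => exact fun W _ Y _ => towerBound_zero Y _
  | succ h ih =>
    intro W _ Y hY
    cases isEmpty_or_nonempty W with
    | inl _ => exact towerBound_of_isEmpty Y _ _
    | inr _ =>
    have hcop : ∀ m, Y.copies (Fin m) = ⊥ := fun m => by
      subst hY
      ext p q
      simp [copies]
    obtain ⟨c, hc⟩ := ih _ _ (hcop (2 * Nat.card W + 2))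
    refine ⟨1 + c + (Nat.card W + 1) * (Nat.card (W × Fin 2) * 4),
      fun V _ G w hw hD F hF C₀ r hr hno => ?_⟩
    refine (hasHittingSet_of_roots hF fun Z hZ x hx C hC =>
      hasHittingSet_of_forall_towerFamily (Y := Y) (N₁ := Nat.card (W × Fin 2) * w)
        (m := 2 * Nat.card W + 2) (by omega) hF hZ.2.1
        (fun hT => hno (hT.subset hZ.1)) ?_ (fun K => hc V G w hw hD F hF K r hr)
        (Nat.card W + 1) C (hC.1.trans Set.sdiff_subset) (hZ.2.1.diff_isComp_singleton hx hC)
        fun 𝒟 h𝒟 hcard => hno ?_).mono ?_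
    · intro F' C hF' hrich
      obtain ⟨D, hD⟩ := hD
      exact D.exists_hitting_set_of_not_richModel_bot hD (hcop 2) hF' hrich
    · exact (h𝒟.hasTower_succ hY (by omega) (hC.1.trans Set.sdiff_subset) hcard).subset hZ.1
    · set L := Nat.log 2 r
      set e := Nat.card (W × Fin 2)
      set d := Nat.card W
      have h1 : 1 ≤ w * (L + 1) := Nat.mul_pos hw (by omega)
      have h2 : (d + 1) * (e * w * (2 * (L + 2))) ≤ (d + 1) * (e * w * (4 * (L + 1))) :=
        Nat.mul_le_mul_left _ (Nat.mul_le_mul_left _ (by omega))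
      nlinarith

end LogStep

/-! ### Universal graphs for rooted 2-treedepth -/

/-- The vertex type of `univGraph n`. -/
def UnivType : ℕ → Type
  | 0 => ℕ
  | n + 1 => List (UnivType n)

/-- A countable graph containing every finite graph of rooted 2-treedepth at most `n + 1`: the
edgeless graph for `n = 0`, and then iterated towers. -/
def univGraph : ∀ n, SimpleGraph (UnivType n)
  | 0 => ⊥
  | n + 1 => tower (univGraph n)

section Univ

theorem towerAdj_nil_cons {W : Type*} {Y : SimpleGraph W} {y : W} {l : List W} :
    TowerAdj Y [] (y :: l) ↔ l = [] :=
  ⟨fun h => by cases h; rfl, fun h => by subst h; exact .down y⟩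

theorem towerAdj_cons_nil {W : Type*} {Y : SimpleGraph W} {y : W} {l : List W} :
    TowerAdj Y (y :: l) [] ↔ l = [] :=
  ⟨fun h => by cases h; rfl, fun h => by subst h; exact .up y⟩

theorem towerAdj_cons_cons {W : Type*} {Y : SimpleGraph W} {y y' : W} {l l' : List W} :
    TowerAdj Y (y :: l) (y' :: l') ↔
      (l = [] ∧ l' = [] ∧ Y.Adj y y') ∨ (y = y' ∧ TowerAdj Y l l') := by
  constructor
  · intro h
    cases h with
    | sibling h => exact Or.inl ⟨rfl, rfl, h⟩
    | cons _ h => exact Or.inr ⟨rfl, h⟩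
  · rintro (⟨rfl, rfl, h⟩ | ⟨rfl, h⟩)
    · exact .sibling h
    · exact .cons _ h

theorem TowerAdj.map {W W' : Type*} {Y : SimpleGraph W} {Y' : SimpleGraph W'} (f : Y →g Y')
    {l l' : List W} (h : TowerAdj Y l l') : TowerAdj Y' (l.map f) (l'.map f) := by
  induction h with
  | down y => exact .down _
  | up y => exact .up _
  | sibling h => exact .sibling (f.map_adj h)
  | cons y _ ih => exact .cons _ ih

theorem TowerAdj.of_map {W W' : Type*} {Y : SimpleGraph W} {Y' : SimpleGraph W'} (f : Y ↪g Y')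
    {l l' : List W} (h : TowerAdj Y' (l.map f) (l'.map f)) : TowerAdj Y l l' := by
  induction l generalizing l' with
  | nil =>
    cases l' with
    | nil => cases h
    | cons y l' =>
      rw [List.map_nil, List.map_cons, towerAdj_nil_cons, List.map_eq_nil_iff] at h
      exact towerAdj_nil_cons.2 h
  | cons y l ih =>
    cases l' with
    | nil =>
      rw [List.map_nil, List.map_cons, towerAdj_cons_nil, List.map_eq_nil_iff] at h
      exact towerAdj_cons_nil.2 h
    | cons y' l' =>
      rw [List.map_cons, List.map_cons, towerAdj_cons_cons, List.map_eq_nil_iff,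
        List.map_eq_nil_iff, f.map_adj_iff, f.injective.eq_iff] at h
      exact towerAdj_cons_cons.2 (h.imp_right fun h => ⟨h.1, ih h.2⟩)

theorem towerAdj_append_singleton {W : Type*} {Y : SimpleGraph W} (l : List W) (y : W) :
    TowerAdj Y l (l ++ [y]) := by
  induction l with
  | nil => exact .down y
  | cons a l ih => exact .cons a ih

theorem towerAdj_append_append {W : Type*} {Y : SimpleGraph W} (l : List W) {y y' : W}
    (h : Y.Adj y y') : TowerAdj Y (l ++ [y]) (l ++ [y']) := by
  induction l with
  | nil => exact .sibling h
  | cons a l ih => exact .cons a ih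

theorem copies_tower_isContained {A : Type*} [Nonempty A] {H : SimpleGraph A}
    (hH : H.copies ℕ ⊑ H) : (tower H).copies ℕ ⊑ tower H := by
  obtain ⟨f⟩ := hH
  obtain ⟨a₀⟩ := ‹Nonempty A›
  set g : H →g H := ⟨fun a => f (a, 0), fun h => f.toHom.map_adj ⟨h, rfl⟩⟩ with hg
  have hginj : Function.Injective g := fun a b hab => congrArg Prod.fst (f.injective hab)
  refine ⟨⟨⟨fun p => f (a₀, p.2) :: p.1.map g, ?_⟩, ?_⟩⟩
  · rintro ⟨l, k⟩ ⟨l', k'⟩ ⟨h, hk⟩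
    obtain rfl : k = k' := hk
    exact .cons _ (TowerAdj.map g h)
  · rintro ⟨l, k⟩ ⟨l', k'⟩ h
    obtain ⟨h1, h2⟩ := List.cons.inj h
    have hk := congrArg Prod.snd (f.injective h1)
    exact Prod.ext (List.map_injective_iff.2 hginj h2) hk

theorem nonempty_univType (n : ℕ) : Nonempty (UnivType n) := by
  cases n with
  | zero => exact ⟨(0 : ℕ)⟩
  | succ n => exact ⟨([] : List (UnivType n))⟩

theorem copies_univGraph_isContained (n : ℕ) : (univGraph n).copies ℕ ⊑ univGraph n := by
  induction n with
  | zero =>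
    exact ⟨⟨⟨fun p : ℕ × ℕ => Nat.pair p.1 p.2, fun h => absurd h.1 (by simp [univGraph])⟩,
      fun p q h => Prod.ext (Nat.pair_eq_pair.1 h).1 (Nat.pair_eq_pair.1 h).2⟩⟩
  | succ n ih =>
    have := nonempty_univType n
    exact copies_tower_isContained ih

/-- A finite subgraph of a tower uses finitely many letters and has bounded height. -/
theorem exists_finite_tower {A : Type} {H : SimpleGraph A} {W : Type*} [Finite W]
    {X : SimpleGraph W} (hX : X ⊑ tower H) :
    ∃ (L : Type) (_ : Finite L) (Y : SimpleGraph L) (h : ℕ) (φ : Copy X (tower Y)),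
      Y ⊑ H ∧ ∀ x, (φ x).length ≤ h := by
  obtain ⟨f⟩ := hX
  set s : Set A := {a | ∃ x, a ∈ f x} with hs
  have hfin : s.Finite := by
    have : s = ⋃ x, {a | a ∈ f x} := by ext a; simp [hs]
    rw [this]
    exact Set.finite_iUnion fun x => List.finite_toSet _
  have hmem : ∀ x, ∀ a ∈ f x, a ∈ s := fun x a ha => ⟨x, ha⟩
  have hval : ∀ x, ((f x).attachWith (· ∈ s) (hmem x)).map (Embedding.induce (G := H) s) = f x :=
    fun x => (List.attachWith_map_val (f := id) (hmem x)).trans (List.map_id _)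
  obtain ⟨h, hh⟩ : ∃ h, ∀ x, (f x).length ≤ h := by
    obtain ⟨M, hM⟩ := (Set.finite_range fun x => (f x).length).bddAbove
    exact ⟨M, fun x => hM ⟨x, rfl⟩⟩
  refine ⟨s, hfin, H.induce s, h, ⟨⟨fun x => (f x).attachWith (· ∈ s) (hmem x), ?_⟩, ?_⟩,
    ⟨(Embedding.induce s).toCopy⟩, fun x => ?_⟩
  · intro x y hxy
    refine TowerAdj.of_map (Embedding.induce s) ?_
    rw [hval x, hval y]
    exact f.toHom.map_adj hxy
  · intro x y hxy
    refine f.injective (?_ : f x = f y)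
    rw [← hval x, ← hval y]
    exact congrArg (List.map _) hxy
  · exact (List.length_attachWith).trans_le (hh x)

end Univ

/-! ### Rooted 2-treedepth and the universal graphs -/

section Rtd

universe u

variable {V : Type u} {G : SimpleGraph V}

theorem Subgraph.card_lt [Finite V] {A : G.Subgraph} {v : V} (hv : v ∉ A.verts) :
    Nat.card A.verts < Nat.card V := by
  rw [Nat.card_coe_set_eq, ← Set.ncard_univ]
  exact Set.ncard_lt_ncard ((Set.ssubset_univ_iff).2 fun h => hv (h ▸ Set.mem_univ v))

/-- For at least two vertices the minimum in the definition of `rtd2` is attained. -/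
theorem exists_separation_rtd2 [Finite V] (hV : 2 ≤ Nat.card V) :
    ∃ A B : G.Subgraph, IsSeparation A B ∧ (A ⊓ B).verts.ncard ≤ 1 ∧ A.verts.Nonempty ∧
      (B.verts \ A.verts).Nonempty ∧
      G.rtd2 = max A.coe.rtd2 ((B.deleteVerts A.verts).coe.rtd2 + (A ⊓ B).verts.ncard) := by
  have hne : {m | ∃ (A B : G.Subgraph) (_ : IsSeparation A B) (_ : (A ⊓ B).verts.ncard ≤ 1)
      (_ : A.verts.Nonempty) (_ : (B.verts \ A.verts).Nonempty),
      m = max (rtd2 A.coe)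
        (rtd2 (B.deleteVerts A.verts).coe + (A ⊓ B).verts.ncard)}.Nonempty := by
    have : Nontrivial V := Finite.one_lt_card_iff_nontrivial.1 hV
    obtain ⟨a, b, hab⟩ := exists_pair_ne V
    refine ⟨_, G.singletonSubgraph a, ⊤, ⟨by simp, ?_⟩, ?_, ⟨a, rfl⟩, ⟨b, trivial, ?_⟩, rfl⟩
    · ext e
      induction e with | _ x y => simp
    · simp
    · simpa using hab.symm
  obtain ⟨A, B, h1, h2, h3, h4, h5⟩ := Nat.sInf_mem hne
  refine ⟨A, B, h1, h2, h3, h4, ?_⟩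
  rw [← h5, rtd2, if_neg (by omega), if_neg (by omega)]

theorem one_le_rtd2 [Finite V] [Nonempty V] : 1 ≤ G.rtd2 := by
  induction hn : Nat.card V using Nat.strong_induction_on generalizing V with
  | _ n ih =>
  have hpos : 0 < Nat.card V := Nat.card_pos
  by_cases h1 : Nat.card V = 1
  · rw [rtd2, if_neg (by omega), if_pos h1]
  obtain ⟨A, B, -, -, hA, ⟨b, hb⟩, heq⟩ := exists_separation_rtd2 (G := G) (by omega)
  have : Nonempty A.verts := hA.to_subtype
  rw [heq]
  exact le_max_of_le_left (ih _ (hn ▸ Subgraph.card_lt hb.2) rfl)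

theorem isContained_of_separation_zero [Finite V] {A B : G.Subgraph} (hAB : A ⊔ B = ⊤)
    (h0 : (A ⊓ B).verts.ncard = 0) {U : Type} {H : SimpleGraph U} (hH : H.copies ℕ ⊑ H)
    (hA : A.coe ⊑ H) (hB : (B.deleteVerts A.verts).coe ⊑ H) : G ⊑ H := by
  classical
  obtain ⟨f⟩ := hA
  obtain ⟨g⟩ := hB
  obtain ⟨c⟩ := hH
  rw [Set.ncard_eq_zero, Subgraph.verts_inf] at h0
  have hcov : ∀ x, x ∉ A.verts → x ∈ (B.deleteVerts A.verts).verts := fun x hx => by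
    have : x ∈ (A ⊔ B).verts := hAB ▸ trivial
    exact ⟨this.resolve_left hx, hx⟩
  have hdis : ∀ x, x ∈ B.verts → x ∉ A.verts := fun x hx hxA =>
    (h0 ▸ (⟨hxA, hx⟩ : x ∈ A.verts ∩ B.verts) : x ∈ (∅ : Set V))
  refine ⟨⟨⟨fun x => if hx : x ∈ A.verts then c (f ⟨x, hx⟩, 0) else c (g ⟨x, hcov x hx⟩, 1),
    ?_⟩, ?_⟩⟩
  · intro x y hxy
    have hadj : (A ⊔ B).Adj x y := by rw [hAB]; exact hxy
    rcases hadj with h | h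
    · simp only [h.fst_mem, h.snd_mem, dif_pos]
      exact c.toHom.map_adj ⟨f.toHom.map_adj h, rfl⟩
    · have hx := hdis x h.fst_mem
      have hy := hdis y h.snd_mem
      simp only [hx, hy, dif_neg, not_false_eq_true]
      refine c.toHom.map_adj ⟨g.toHom.map_adj ?_, rfl⟩
      simpa [Subgraph.deleteVerts_adj, h.fst_mem, h.snd_mem, hx, hy] using h
  · intro x y hxy
    change (if hx : x ∈ A.verts then c (f ⟨x, hx⟩, 0) else c (g ⟨x, hcov x hx⟩, 1)) =
      (if hy : y ∈ A.verts then c (f ⟨y, hy⟩, 0) else c (g ⟨y, hcov y hy⟩, 1)) at hxy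
    split_ifs at hxy with hx hy hy
    · exact congrArg Subtype.val (f.injective (congrArg Prod.fst (c.injective hxy)))
    · exact absurd (congrArg Prod.snd (c.injective hxy)) (by simp)
    · exact absurd (congrArg Prod.snd (c.injective hxy)) (by simp)
    · exact congrArg Subtype.val (g.injective (congrArg Prod.fst (c.injective hxy)))

/-- If `A` meets `B` in the single vertex `v`, then `B - v` can be placed as a copy among the
one-letter extensions of the word of `v`. -/
theorem isContained_tower_of_separation_one {A B : G.Subgraph} (hAB : A ⊔ B = ⊤)
    {v : V} (hv : (A ⊓ B).verts = {v}) {U : Type} {H : SimpleGraph U} (hH : H.copies ℕ ⊑ H)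
    (hA : A.coe ⊑ tower H) (hB : (B.deleteVerts A.verts).coe ⊑ H) : G ⊑ tower H := by
  classical
  obtain ⟨f⟩ := hA
  obtain ⟨g⟩ := hB
  obtain ⟨c⟩ := hH
  rw [Subgraph.verts_inf] at hv
  have hvA : v ∈ A.verts := (hv ▸ rfl : v ∈ A.verts ∩ B.verts).1
  have hAv : ∀ x, x ∈ A.verts → x ∈ B.verts → x = v := fun x hx hxB =>
    (hv ▸ (⟨hx, hxB⟩ : x ∈ A.verts ∩ B.verts) : x ∈ ({v} : Set V))
  have hcov : ∀ x, x ∉ A.verts → x ∈ (B.deleteVerts A.verts).verts := fun x hx => by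
    have : x ∈ (A ⊔ B).verts := hAB ▸ trivial
    exact ⟨this.resolve_left hx, hx⟩
  set c₀ : H →g H := ⟨fun a => c (a, 0), fun h => c.toHom.map_adj ⟨h, rfl⟩⟩ with hc₀
  have hc₀inj : Function.Injective c₀ := fun a b hab => congrArg Prod.fst (c.injective hab)
  have hc₀1 : ∀ a b, c₀ a ≠ c (b, 1) := fun a b hab =>
    absurd (congrArg Prod.snd (c.injective hab)) (by simp)
  have hlast : ∀ (l l' : List U) b, l.map c₀ ≠ l' ++ [c (b, 1)] := by
    intro l l' b h
    have : c (b, 1) ∈ l.map c₀ := h ▸ by simp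
    obtain ⟨a, -, ha⟩ := List.mem_map.1 this
    exact hc₀1 a b ha
  set φ : V → List U := fun x => if hx : x ∈ A.verts then (f ⟨x, hx⟩).map c₀
    else (f ⟨v, hvA⟩).map c₀ ++ [c (g ⟨x, hcov x hx⟩, 1)] with hφ
  have hφA : ∀ x (hx : x ∈ A.verts), φ x = (f ⟨x, hx⟩).map c₀ := fun x hx => by simp [hφ, hx]
  have hφB : ∀ x (hx : x ∉ A.verts),
      φ x = (f ⟨v, hvA⟩).map c₀ ++ [c (g ⟨x, hcov x hx⟩, 1)] := fun x hx => by simp [hφ, hx]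
  refine ⟨⟨⟨φ, ?_⟩, ?_⟩⟩
  · intro x y hxy
    have hadj : (A ⊔ B).Adj x y := by rw [hAB]; exact hxy
    rcases hadj with h | h
    · rw [hφA x h.fst_mem, hφA y h.snd_mem]
      exact TowerAdj.map c₀ (f.toHom.map_adj h)
    by_cases hx : x ∈ A.verts
    · obtain rfl := hAv x hx h.fst_mem
      by_cases hy : y ∈ A.verts
      · exact absurd (hAv y hy h.snd_mem).symm hxy.ne
      · rw [hφA _ hx, hφB y hy]
        exact towerAdj_append_singleton _ _
    · by_cases hy : y ∈ A.verts
      · obtain rfl := hAv y hy h.snd_mem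
        rw [hφA _ hy, hφB x hx]
        exact (tower H).symm.symm _ _ (towerAdj_append_singleton _ _)
      · rw [hφB x hx, hφB y hy]
        refine towerAdj_append_append _ (c.toHom.map_adj ⟨g.toHom.map_adj ?_, rfl⟩)
        simpa [Subgraph.deleteVerts_adj, h.fst_mem, h.snd_mem, hx, hy] using h
  · intro x y hxy
    change φ x = φ y at hxy
    by_cases hx : x ∈ A.verts
    · by_cases hy : y ∈ A.verts
      · rw [hφA x hx, hφA y hy] at hxy
        exact congrArg Subtype.val (f.injective (List.map_injective_iff.2 hc₀inj hxy))
      · rw [hφA x hx, hφB y hy] at hxy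
        exact absurd hxy (hlast _ _ _)
    · by_cases hy : y ∈ A.verts
      · rw [hφB x hx, hφA y hy] at hxy
        exact absurd hxy.symm (hlast _ _ _)
      · rw [hφB x hx, hφB y hy, List.append_cancel_left_eq, List.singleton_inj] at hxy
        exact congrArg Subtype.val (g.injective (congrArg Prod.fst (c.injective hxy)))

theorem isContained_univGraph_of_rtd2_le [Finite V] (n : ℕ) (hG : G.rtd2 ≤ n + 1) :
    G ⊑ univGraph n := by
  induction hm : Nat.card V using Nat.strong_induction_on generalizing V n with
  | _ m ih =>
  subst hm
  by_cases hV : Nat.card V ≤ 1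
  · have : Subsingleton V := Finite.card_le_one_iff_subsingleton.1 hV
    obtain ⟨a⟩ := nonempty_univType n
    exact ⟨⟨⟨fun _ => a, fun {x y} h => absurd (Subsingleton.elim x y) h.ne⟩,
      fun x y _ => Subsingleton.elim x y⟩⟩
  obtain ⟨A, B, hAB, hord, ⟨a, ha⟩, ⟨b, hb⟩, heq⟩ := exists_separation_rtd2 (G := G) (by omega)
  rw [heq, max_le_iff] at hG
  have hA := Subgraph.card_lt (A := A) hb.2
  have hB := Subgraph.card_lt (A := B.deleteVerts A.verts) (v := a) fun h => h.2 ha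
  have hAn := ih _ hA n hG.1 rfl
  rcases Nat.le_one_iff_eq_zero_or_eq_one.1 hord with h0 | h1
  · rw [h0] at hG
    exact isContained_of_separation_zero hAB.1 h0 (copies_univGraph_isContained n) hAn
      (ih _ hB n hG.2 rfl)
  · have : Nonempty (B.deleteVerts A.verts).verts := ⟨⟨b, hb⟩⟩
    have hpos := one_le_rtd2 (G := (B.deleteVerts A.verts).coe)
    rw [h1] at hG
    obtain ⟨k, rfl⟩ : ∃ k, n = k + 1 := ⟨n - 1, by omega⟩
    obtain ⟨v, hv⟩ := Set.ncard_eq_one.1 h1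
    exact isContained_tower_of_separation_one hAB.1 hv (copies_univGraph_isContained k) hAn
      (ih _ hB k (by omega) rfl)

end Rtd

/-! ### The bound for all levels -/

section Levels

universe v

theorem hitBound_of_towerBound {A : Type} {H : SimpleGraph A} {g : ℕ → ℕ}
    (hT : ∀ h, ∀ (W : Type) [Finite W] (Y : SimpleGraph W), Y ⊑ H → TowerBound.{v} Y h g)
    {W : Type*} [Finite W] {X : SimpleGraph W} (hX : X ⊑ tower H) : HitBound.{v} X g := by
  obtain ⟨L, hL, Y, h, φ, hY, hφ⟩ := exists_finite_tower hX
  obtain ⟨c, hc⟩ := hT h L Y hY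
  exact ⟨c, fun V _ G w hw hD F hF C r hr hno =>
    hc V G w hw hD F hF C r hr fun hT => hno (hT.richModel φ hφ)⟩

theorem hitBound_univGraph (n : ℕ) {W : Type*} [Finite W] {X : SimpleGraph W}
    (hX : X ⊑ univGraph (n + 1)) : HitBound.{v} X fun r => r ^ n * (Nat.log 2 r + 1) := by
  have key : ∀ n h, ∀ (W : Type) [Finite W] (Y : SimpleGraph W), Y ⊑ univGraph n →
      TowerBound.{v} Y h fun r => r ^ n * (Nat.log 2 r + 1) := by
    intro n
    induction n with
    | zero =>
      intro h W _ Y hY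
      simp only [pow_zero, one_mul]
      refine towerBound_log h W Y ?_
      obtain ⟨f⟩ := hY
      ext x y
      exact ⟨fun h => f.toHom.map_adj h, fun h => h.elim⟩
    | succ n ih =>
      intro h W _ Y hY
      have := towerBound_of_hitBound (copies_univGraph_isContained (n + 1))
        (fun r hr => Nat.mul_pos (pow_pos hr n) (Nat.succ_pos _))
        (fun W _ Y hY => hitBound_of_towerBound ih hY) h W Y hY
      simpa only [pow_succ', mul_assoc] using this
  exact hitBound_of_towerBound (key n) hX

end Levels

/-! ### Weak coloring numbers and treewidth -/

section Wcol

variable {V : Type*} {G : SimpleGraph V}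

/-- A hitting set for the family of all singletons is the whole vertex set, and its ordering, with
ties broken arbitrarily, bounds the weak coloring number. A walk with `r` edges makes `r + 1`
visits. -/
theorem wcol_le_of_hasHittingSet [Finite V] {r N : ℕ}
    (h : G.HasHittingSet (Set.range fun v : V => ({v} : Set V)) Set.univ (r + 1) N) :
    G.wcol r ≤ N := by
  obtain ⟨S, ρ, -, hhit, hN⟩ := h
  have hS : S = Set.univ := Set.eq_univ_of_forall fun v => by
    obtain ⟨x, hx, hxS⟩ := hhit {v} ⟨v, rfl⟩ (Set.subset_univ _)
    rwa [Set.mem_singleton_iff.1 hx] at hxS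
  subst hS
  have e : V ≃ Fin (Nat.card V) := Finite.equivFin V
  have hmono := Tuple.monotone_sort (ρ ∘ e.symm)
  set σ : V ≃ Fin (Nat.card V) := e.trans (Tuple.sort (ρ ∘ e.symm)).symm with hσ
  have hρσ : ∀ v w, σ v ≤ σ w → ρ v ≤ ρ w := fun v w hvw => by
    have := hmono hvw
    simpa [hσ] using this
  have hsub : ∀ u, G.WReach σ r u ⊆ G.WR Set.univ Set.univ ρ (r + 1) u := by
    rintro u v ⟨p, -, hlen, hp⟩
    refine ⟨trivial, Tour.mono (Tour.of_walk (S := Set.univ) (A := {w | w ∈ Set.univ ∧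
      (w ∈ Set.univ → ρ v ≤ ρ w)}) p fun w hw => ⟨trivial, fun _ => hρσ v w (hp w hw)⟩)
      subset_rfl subset_rfl (by omega)⟩
  refine (ciInf_le (OrderBot.bddBelow _) σ).trans ?_
  cases isEmpty_or_nonempty V with
  | inl _ => simp
  | inr _ => exact ciSup_le fun u => (Set.ncard_le_ncard (hsub u)).trans (hN u)

theorem exists_treeDecomposition_treewidth [Finite V] (G : SimpleGraph V) :
    ∃ D : G.TreeDecomposition, D.width = G.treewidth := by
  have hne : Nonempty G.TreeDecomposition := ⟨{
    node := Unit
    finite_node := inferInstance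
    tree := ⊥
    isTree := .of_subsingleton
    bag := fun _ => Set.univ
    connected_of_mem := fun u => connSet_iff_induce_connected.1 <| by
      convert ConnSet.singleton (G := (⊥ : SimpleGraph Unit)) ()
      ext
      simp
    exists_bag_of_adj := fun _ _ _ => ⟨(), trivial, trivial⟩ }⟩
  have hbdd : BddBelow (Set.range fun D : G.TreeDecomposition => D.width) := by
    refine ⟨-1, ?_⟩
    rintro _ ⟨D, rfl⟩
    simp only [TreeDecomposition.width]
    omega
  exact Int.csInf_mem (Set.range_nonempty _) hbdd

theorem exists_treeDecomposition_bag_le [Finite V] (G : SimpleGraph V) :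
    ∃ w : ℕ, (w : ℤ) = G.treewidth + 1 ∧
      ∃ D : G.TreeDecomposition, ∀ x, (D.bag x).ncard ≤ w := by
  obtain ⟨D, hD⟩ := exists_treeDecomposition_treewidth G
  have := D.finite_node
  refine ⟨⨆ x : D.node, (D.bag x).ncard, ?_, D, fun x => ?_⟩
  · rw [← hD, TreeDecomposition.width]
    ring
  · exact le_ciSup (f := fun x => (D.bag x).ncard) (Set.finite_range _).bddAbove x

theorem RichModel.isMinor {W : Type*} {X : SimpleGraph W} {F : Set (Set V)} {C : Set V}
    (h : G.RichModel F X C) : X.IsMinor G := by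
  obtain ⟨B, h1, h2, h3⟩ := h
  exact ⟨B, h2, fun x => connSet_iff_induce_connected.1 (h1 x).2.1, h3⟩

end Wcol

/-- Replacing the radius `r` by `r + 1` and the binary logarithm by the natural one only affects the
constant. -/
theorem pow_mul_log_succ_le (n r : ℕ) (hr : 2 ≤ r) :
    (((r + 1) ^ n * (Nat.log 2 (r + 1) + 1) : ℕ) : ℝ) ≤ 2 ^ n * 6 * (r ^ n * Real.log r) := by
  have hr0 : (2 : ℝ) ≤ r := by exact_mod_cast hr
  have hlog2 : (1 / 2 : ℝ) ≤ Real.log 2 := by linarith [Real.log_two_gt_d9]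
  have hlogr : Real.log 2 ≤ Real.log r := Real.log_le_log (by norm_num) hr0
  have h1 : Nat.log 2 (r + 1) ≤ Nat.log 2 r + 1 := by
    rw [← Nat.log_mul_base (by norm_num) (by omega)]
    exact Nat.log_mono_right (by omega)
  have h2 : (Nat.log 2 r : ℝ) * Real.log 2 ≤ Real.log r := by
    rw [← Real.log_pow]
    exact Real.log_le_log (by positivity)
      (by exact_mod_cast Nat.pow_log_le_self 2 (by omega : r ≠ 0))
  have h3 : (Nat.log 2 r : ℝ) ≤ 2 * Real.log r := by
    nlinarith [(Nat.cast_nonneg (Nat.log 2 r) : (0 : ℝ) ≤ _)]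
  have h4 : ((Nat.log 2 (r + 1) + 1 : ℕ) : ℝ) ≤ 6 * Real.log r := by
    have : ((Nat.log 2 (r + 1) + 1 : ℕ) : ℝ) ≤ (Nat.log 2 r : ℝ) + 2 := by
      exact_mod_cast (by omega : Nat.log 2 (r + 1) + 1 ≤ Nat.log 2 r + 2)
    linarith
  have h5 : (((r + 1) ^ n : ℕ) : ℝ) ≤ 2 ^ n * r ^ n := by
    rw [← mul_pow]
    push_cast
    exact pow_le_pow_left₀ (by positivity) (by linarith) n
  calc (((r + 1) ^ n * (Nat.log 2 (r + 1) + 1) : ℕ) : ℝ)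
      = (((r + 1) ^ n : ℕ) : ℝ) * ((Nat.log 2 (r + 1) + 1 : ℕ) : ℝ) := by push_cast; ring
    _ ≤ (2 ^ n * r ^ n) * (6 * Real.log r) :=
        mul_le_mul h5 h4 (Nat.cast_nonneg _) (by positivity)
    _ = _ := by ring

end SimpleGraph

theorem mainTheorem2 (t : ℕ) (ht : 2 ≤ t) {W : Type*} [Finite W] (X : SimpleGraph W)
    (hX : X.rtd2 ≤ t) :
    ∃ c : ℤ, ∀ (V : Type*) [Finite V] (G : SimpleGraph V), ¬ X.IsMinor G →
      ∀ r : ℕ, 2 ≤ r →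
        (G.wcol r : ℝ) ≤ (c : ℝ) * ((G.treewidth : ℝ) + 1) * (r : ℝ) ^ (t - 2) * Real.log r := by
  obtain ⟨n, rfl⟩ : ∃ n, t = n + 2 := ⟨t - 2, by omega⟩
  obtain ⟨c, hc⟩ := SimpleGraph.hitBound_univGraph n
    (SimpleGraph.isContained_univGraph_of_rtd2_le (n + 1) hX)
  refine ⟨c * (2 ^ n * 6), fun V _ G hG r hr => ?_⟩
  obtain ⟨w, hw, D, hD⟩ := SimpleGraph.exists_treeDecomposition_bag_le G
  have hwr : (G.treewidth : ℝ) + 1 = w := by exact_mod_cast hw.symm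
  have hwcol : G.wcol r ≤ c * w * ((r + 1) ^ n * (Nat.log 2 (r + 1) + 1)) := by
    rcases Nat.eq_zero_or_pos w with rfl | hwpos
    · -- all bags are empty, so there are no vertices
      have : IsEmpty V := ⟨fun v => by
        obtain ⟨⟨x, hx⟩⟩ := (D.connected_of_mem v).nonempty
        have h0 := hD x
        rw [Nat.le_zero, Set.ncard_eq_zero] at h0
        exact (h0 ▸ hx : v ∈ (∅ : Set V))⟩
      refine (ciInf_le (OrderBot.bddBelow _) (Finite.equivFin V)).trans ?_
      simp
    · refine SimpleGraph.wcol_le_of_hasHittingSet (hc V G w hwpos ⟨D, hD⟩ _ ?_ _ _ (by omega)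
        fun h => hG h.isMinor)
      rintro _ ⟨v, rfl⟩
      exact SimpleGraph.ConnSet.singleton v
  have hbound := SimpleGraph.pow_mul_log_succ_le n r hr
  calc (G.wcol r : ℝ) ≤ ((c * w * ((r + 1) ^ n * (Nat.log 2 (r + 1) + 1)) : ℕ) : ℝ) := by
        exact_mod_cast hwcol
    _ = (c * w : ℝ) * (((r + 1) ^ n * (Nat.log 2 (r + 1) + 1) : ℕ) : ℝ) := by push_cast; ring
    _ ≤ (c * w : ℝ) * (2 ^ n * 6 * (r ^ n * Real.log r)) :=
        mul_le_mul_of_nonneg_left hbound (by positivity)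
    _ = _ := by
        rw [hwr, Nat.add_sub_cancel]
        push_cast
        ring
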